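/- Let $G=\operatorname{SL}_2(\mathbb{R})$, $\Gamma=\operatorname{SL}_2(\mathbb{Z})$, $X=G/\Gamma$, let $\mu_X$ be the Haar probability measure on $X$ (the unique $G$-invariant Borel probability measure), and let $a_t=\begin{pmatrix} e^{t/2}&0\\0&e^{-t/2}\end{pmatrix}\in G$ for $t\in\mathbb{R}$. For a finite non-empty set $\Omega$ of probability Radon measures on $X$ put $\mathrm{Avg}(\Omega)=\frac1{|\Omega|}\sum_{\nu\in\Omega}\nu$. Weak* convergence of measures on $X$ means convergence of integrals of all compactly supported continuous functions, and a weak* limit point of a sequence of measures is a finite Borel measure which is the weak* limit of a subsequence. Let $(\Omega_q)_{q\in\mathbb{N}}$ be a sequence of finite non-empty sets of probability Radon measures on $X$ which is uniformly almost invariant: for every choice of non-empty subsets $\Omega_q'\subseteq\Omega_q$ ($q\in\mathbb{N}$), every weak* limit point of the sequence $\mathrm{Avg}(\Omega_q')$ is invariant under $a_t$ for all $t\in\mathbb{R}$. Suppose that $\mathrm{Avg}(\Omega_q)\to\mu_X$ weak* as $q\to\infty$. Then there exist non-empty subsets $\Omega_q'\subseteq\Omega_q$ such that $\frac{|\Omega_q'|}{|\Omega_q|}\to1$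 as $q\to\infty$ and such that for every choice of a sequence $\nu_q\in\Omega_q'$ ($q\in\mathbb{N}$) one has $\nu_q\to\mu_X$ weak*. -/

import Mathlib

open MeasureTheory Filter Topology
open scoped MatrixGroups ENNReal CompactlySupported

namespace LatticeSpace

/-- The image of `SL₂(ℤ)` in `SL₂(ℝ)`. -/
def Gamma : Subgroup SL(2, ℝ) :=
  (Matrix.SpecialLinearGroup.map (n := Fin 2) (Int.castRingHom ℝ)).range

/-- The space of unimodular lattices in the plane, `SL₂(ℝ)/SL₂(ℤ)`, with the quotient topology, the
left translation action and the Borel `σ`-algebra. -/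
def X : Type := SL(2, ℝ) ⧸ Gamma

instance : TopologicalSpace X := inferInstanceAs (TopologicalSpace (SL(2, ℝ) ⧸ Gamma))
instance : MulAction SL(2, ℝ) X := inferInstanceAs (MulAction SL(2, ℝ) (SL(2, ℝ) ⧸ Gamma))
instance : MeasurableSpace X := borel X
instance : BorelSpace X := ⟨rfl⟩
instance : ContinuousSMul SL(2, ℝ) X :=
  inferInstanceAs (ContinuousSMul SL(2, ℝ) (SL(2, ℝ) ⧸ Gamma))

/-- The defining properties of the Haar probability measure on `X`: it is a Borel probability measure
invariant under left translation by `SL₂(ℝ)`. -/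
def IsHaarProbability (μ : Measure X) : Prop :=
  IsProbabilityMeasure μ ∧ ∀ g : SL(2, ℝ), μ.map (fun x => g • x) = μ

/-- Real `2 × 2` matrices, as pairs (first column, second column), with Lebesgue measure. -/
abbrev Cols : Type := (ℝ × ℝ) × (ℝ × ℝ)

/-- The determinant. -/
def cdet (x : Cols) : ℝ := x.1.1 * x.2.2 - x.2.1 * x.1.2

/-- Right multiplication by an integer matrix of determinant one. -/
def rmul (γ : SL(2, ℤ)) (x : Cols) : Cols :=
  ((γ 0 0 : ℝ) • x.1 + (γ 1 0 : ℝ) • x.2, (γ 0 1 : ℝ) • x.1 + (γ 1 1 : ℝ) • x.2)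

/-- A matrix in `SL₂(ℝ)` acting on column vectors. -/
noncomputable def lin (g : SL(2, ℝ)) : (ℝ × ℝ) →ₗ[ℝ] (ℝ × ℝ) :=
  Matrix.toLin (Module.Basis.finTwoProd ℝ) (Module.Basis.finTwoProd ℝ) (g : Matrix (Fin 2) (Fin 2) ℝ)

theorem lin_apply (g : SL(2, ℝ)) (v : ℝ × ℝ) :
    lin g v = (g 0 0 * v.1 + g 0 1 * v.2, g 1 0 * v.1 + g 1 1 * v.2) := by
  have h : (g : Matrix (Fin 2) (Fin 2) ℝ) = !![g 0 0, g 0 1; g 1 0, g 1 1] :=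
    Matrix.eta_fin_two _
  rw [lin, h, Matrix.toLin_finTwoProd_apply]; rfl

/-- Left multiplication by a matrix in `SL₂(ℝ)`. -/
noncomputable def lmul (g : SL(2, ℝ)) (x : Cols) : Cols := (lin g x.1, lin g x.2)

theorem mp_lin (g : SL(2, ℝ)) : MeasurePreserving (lin g) (volume : Measure (ℝ × ℝ)) volume := by
  have hd : LinearMap.det (lin g) = 1 := by
    rw [lin, LinearMap.det_toLin]; exact g.2
  refine ⟨(lin g).continuous_of_finiteDimensional.measurable, ?_⟩
  rw [Measure.map_linearMap_addHaar_eq_smul_addHaar _ (by rw [hd]; exact one_ne_zero), hd]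
  simp

theorem mp_lmul (g : SL(2, ℝ)) : MeasurePreserving (lmul g) (volume : Measure Cols) volume :=
  (mp_lin g).prod (mp_lin g)

theorem rmul_mul (γ δ : SL(2, ℤ)) (x : Cols) : rmul (γ * δ) x = rmul δ (rmul γ x) := by
  have h : ∀ i j, (γ * δ) i j = γ i 0 * δ 0 j + γ i 1 * δ 1 j := by
    intro i j
    rw [Matrix.SpecialLinearGroup.coe_mul, Matrix.mul_apply, Fin.sum_univ_two]
  simp only [rmul, h]
  ext <;> simp <;> ring

theorem rmul_one (x : Cols) : rmul 1 x = x := by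
  simp [rmul]

theorem cdet_rmul (γ : SL(2, ℤ)) (x : Cols) : cdet (rmul γ x) = cdet x := by
  have h : (γ 0 0 : ℝ) * γ 1 1 - γ 0 1 * γ 1 0 = 1 := by
    have := γ.2
    rw [Matrix.det_fin_two] at this
    exact_mod_cast this
  simp only [cdet, rmul, Prod.fst_add, Prod.snd_add, Prod.smul_fst, Prod.smul_snd, smul_eq_mul]
  linear_combination (x.1.1 * x.2.2 - x.2.1 * x.1.2) * h

theorem cdet_lmul (g : SL(2, ℝ)) (x : Cols) : cdet (lmul g x) = cdet x := by
  have h : g 0 0 * g 1 1 - g 0 1 * g 1 0 = 1 := by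
    have := g.2
    rwa [Matrix.det_fin_two] at this
  simp only [cdet, lmul, lin_apply]
  linear_combination (x.1.1 * x.2.2 - x.2.1 * x.1.2) * h

theorem lmul_rmul (g : SL(2, ℝ)) (γ : SL(2, ℤ)) (x : Cols) :
    lmul g (rmul γ x) = rmul γ (lmul g x) := by
  simp [lmul, rmul]

theorem lmul_mul (g h : SL(2, ℝ)) (x : Cols) : lmul (g * h) x = lmul g (lmul h x) := by
  have e : ∀ i j, (g * h) i j = g i 0 * h 0 j + g i 1 * h 1 j := by
    intro i j
    rw [Matrix.SpecialLinearGroup.coe_mul, Matrix.mul_apply, Fin.sum_univ_two]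
  simp only [lmul, lin_apply, e]
  ext <;> simp <;> ring

theorem lmul_one (x : Cols) : lmul 1 x = x := by
  simp [lmul, lin_apply]

theorem mp_rmul (γ : SL(2, ℤ)) : MeasurePreserving (rmul γ) (volume : Measure Cols) volume := by
  have hγ : γ ∈ Subgroup.closure {ModularGroup.S, ModularGroup.T} := by
    rw [SpecialLinearGroup.SL2Z_generators]; trivial
  have hmeas : ∀ γ, Measurable (rmul γ) := by
    intro γ; unfold rmul; fun_prop
  induction hγ using Subgroup.closure_induction with
  | mem γ h =>
    rcases h with rfl | rfl
    · have h1 : MeasurePreserving (Prod.swap : Cols → Cols) volume volume :=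
        Measure.measurePreserving_swap
      have h2 : MeasurePreserving (Prod.map id (fun v => -v) : Cols → Cols) volume volume :=
        (MeasurePreserving.id _).prod (Measure.measurePreserving_neg _)
      convert h2.comp h1 using 1
      funext x
      ext <;> simp [rmul, ModularGroup.S]
    · have h1 : MeasurePreserving (fun p : Cols => (p.1, p.1 + p.2)) volume volume :=
        (MeasurePreserving.id _).skew_product (by fun_prop)
          (Eventually.of_forall fun v => (measurePreserving_add_left _ v).map_eq)
      convert h1 using 1
      funext x
      ext <;> simp [rmul, ModularGroup.T]
  | one => convert MeasurePreserving.id _ using 1; funext x; exact rmul_one x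
  | mul γ δ _ _ h1 h2 =>
    convert h2.comp h1 using 1; funext x; exact rmul_mul γ δ x
  | inv γ _ h =>
    refine ⟨hmeas _, ?_⟩
    conv_lhs => rw [← h.map_eq]
    rw [Measure.map_map (hmeas _) (hmeas _)]
    have : rmul γ⁻¹ ∘ rmul γ = id := by
      funext x; simp [← rmul_mul, rmul_one]
    rw [this, Measure.map_id]

/-- A matrix `A` of positive determinant, scaled to `A / √(det A)` in `SL₂(ℝ)`. -/
noncomputable def toG (x : Cols) : SL(2, ℝ) :=
  if h : 0 < cdet x then
    ⟨(√(cdet x))⁻¹ • !![x.1.1, x.2.1; x.1.2, x.2.2], by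
      have h2 := Real.sq_sqrt h.le
      have h3 : √(cdet x) ≠ 0 := (Real.sqrt_pos.2 h).ne'
      rw [Matrix.det_smul, Matrix.det_fin_two_of]
      change _ * cdet x = 1
      simp only [Fintype.card_fin]
      rw [inv_pow, h2, inv_mul_cancel₀ h.ne']⟩
  else 1

theorem coe_toG {x : Cols} (h : 0 < cdet x) :
    (toG x : Matrix (Fin 2) (Fin 2) ℝ) = (√(cdet x))⁻¹ • !![x.1.1, x.2.1; x.1.2, x.2.2] := by
  simp [toG, h]

theorem toG_of_not {x : Cols} (h : ¬ 0 < cdet x) : toG x = 1 := by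
  unfold toG
  exact dif_neg h

theorem toG_lmul (g : SL(2, ℝ)) {x : Cols} (h : 0 < cdet x) : toG (lmul g x) = g * toG x := by
  apply Subtype.ext
  rw [coe_toG (by rwa [cdet_lmul]), Matrix.SpecialLinearGroup.coe_mul, coe_toG h, cdet_lmul,
    Matrix.mul_smul]
  congr 1
  ext i j
  fin_cases i <;> fin_cases j <;> simp [lmul, lin_apply, Matrix.mul_apply, Fin.sum_univ_two]

theorem toG_rmul (γ : SL(2, ℤ)) {x : Cols} (h : 0 < cdet x) :
    toG (rmul γ x) = toG x * Matrix.SpecialLinearGroup.map (Int.castRingHom ℝ) γ := by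
  apply Subtype.ext
  rw [coe_toG (by rwa [cdet_rmul]), Matrix.SpecialLinearGroup.coe_mul, coe_toG h, cdet_rmul,
    Matrix.smul_mul]
  congr 1
  ext i j
  fin_cases i <;> fin_cases j <;> simp [rmul, Matrix.mul_apply, Fin.sum_univ_two] <;> ring

/-- The class in `X` of `A / √(det A)`. -/
noncomputable def toX (x : Cols) : X := (QuotientGroup.mk (toG x) : SL(2, ℝ) ⧸ Gamma)

theorem toX_lmul (g : SL(2, ℝ)) {x : Cols} (h : 0 < cdet x) : toX (lmul g x) = g • toX x := by
  unfold toX; rw [toG_lmul g h]; rfl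

theorem toX_rmul (γ : SL(2, ℤ)) {x : Cols} (h : 0 < cdet x) : toX (rmul γ x) = toX x := by
  unfold toX; rw [toG_rmul γ h]
  exact (QuotientGroup.mk_mul_of_mem _ ⟨γ, rfl⟩)

theorem continuous_cdet : Continuous cdet := by unfold cdet; fun_prop

theorem measurable_toX : Measurable toX := by
  classical
  have hc : ContinuousOn toX {x | 0 < cdet x} := by
    rw [continuousOn_iff_continuous_domRestrict]
    have : Continuous (fun x : {x | 0 < cdet x} => toG x.1) := by
      refine Continuous.subtype_mk (f := fun x : {x | 0 < cdet x} =>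
        ((√(cdet x.1))⁻¹ • !![x.1.1.1, x.1.2.1; x.1.1.2, x.1.2.2] : Matrix (Fin 2) (Fin 2) ℝ))
        ?_ (fun x => ?_) |>.congr ?_
      · have h1 : Continuous fun x : {x | 0 < cdet x} => (√(cdet x.1))⁻¹ :=
          (Real.continuous_sqrt.comp (continuous_cdet.comp continuous_subtype_val)).inv₀
            fun x => (Real.sqrt_pos.2 x.2).ne'
        refine h1.smul ?_
        refine continuous_matrix fun i j => ?_
        fin_cases i <;> fin_cases j <;> simp <;> fun_prop
      · have := (toG x.1).2
        rwa [coe_toG x.2] at this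
      · intro x; apply Subtype.ext; exact (coe_toG x.2).symm
    exact QuotientGroup.continuous_mk.comp this
  have h := hc.measurable_piecewise (g := fun _ => toX 0) continuousOn_const
    (isOpen_lt continuous_const continuous_cdet).measurableSet
  convert h using 1
  funext x
  by_cases hx : 0 < cdet x
  · simp [hx]
  · have h0 : ¬ 0 < cdet 0 := by simp [cdet]
    rw [Set.piecewise_eq_of_notMem _ _ _ (show x ∉ {x | 0 < cdet x} from hx)]
    unfold toX
    rw [toG_of_not h0, toG_of_not hx]


/-- Matrices with determinant in `(0, 1]` whose columns form a Gauss reduced basis: they meet every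
right `SL₂(ℤ)`-orbit of matrices with determinant in `(0, 1]`, finitely often. -/
def Red : Set Cols :=
  {x | 0 < cdet x ∧ cdet x ≤ 1 ∧ x.1.1 ^ 2 + x.1.2 ^ 2 ≤ x.2.1 ^ 2 + x.2.2 ^ 2 ∧
    2 * |x.1.1 * x.2.1 + x.1.2 * x.2.2| ≤ x.1.1 ^ 2 + x.1.2 ^ 2}

theorem measurableSet_Red : MeasurableSet Red := by
  have h := continuous_cdet
  have h1 : MeasurableSet {x : Cols | 0 < cdet x} := (isOpen_lt continuous_const h).measurableSet
  have h2 : MeasurableSet {x : Cols | cdet x ≤ 1} := (isClosed_le h continuous_const).measurableSet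
  have h3 : MeasurableSet {x : Cols | x.1.1 ^ 2 + x.1.2 ^ 2 ≤ x.2.1 ^ 2 + x.2.2 ^ 2} :=
    (isClosed_le (by fun_prop) (by fun_prop)).measurableSet
  have h4 : MeasurableSet {x : Cols | 2 * |x.1.1 * x.2.1 + x.1.2 * x.2.2| ≤
      x.1.1 ^ 2 + x.1.2 ^ 2} :=
    (isClosed_le (by fun_prop) (by fun_prop)).measurableSet
  exact h1.inter (h2.inter (h3.inter h4))

theorem red_bound {x : Cols} (hx : x ∈ Red) :
    3 * (x.1.1 ^ 2 + x.1.2 ^ 2) ^ 2 ≤ 4 * cdet x ^ 2 ∧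
    4 * ((x.1.1 ^ 2 + x.1.2 ^ 2) * (x.2.1 ^ 2 + x.2.2 ^ 2)) ≤
      (x.1.1 ^ 2 + x.1.2 ^ 2) ^ 2 + 4 * cdet x ^ 2 := by
  obtain ⟨h1, h2, h3, h4⟩ := hx
  have h5 : 4 * (x.1.1 * x.2.1 + x.1.2 * x.2.2) ^ 2 ≤ (x.1.1 ^ 2 + x.1.2 ^ 2) ^ 2 := by
    rw [← sq_abs (x.1.1 * x.2.1 + x.1.2 * x.2.2)]
    nlinarith [abs_nonneg (x.1.1 * x.2.1 + x.1.2 * x.2.2)]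
  have h6 : (x.1.1 ^ 2 + x.1.2 ^ 2) * (x.2.1 ^ 2 + x.2.2 ^ 2) =
      (x.1.1 * x.2.1 + x.1.2 * x.2.2) ^ 2 + cdet x ^ 2 := by
    unfold cdet; ring
  have h7 : (x.1.1 ^ 2 + x.1.2 ^ 2) ^ 2 ≤ (x.1.1 ^ 2 + x.1.2 ^ 2) * (x.2.1 ^ 2 + x.2.2 ^ 2) := by
    rw [sq (_ + _)]
    exact mul_le_mul_of_nonneg_left h3 (by positivity)
  constructor <;> linarith

theorem volume_Red_lt_top : volume Red < ∞ := by
  have hs : ∀ v : ℝ × ℝ, volume (Prod.mk v ⁻¹' Red) ≤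
      (Set.Icc ((-2, -2) : ℝ × ℝ) (2, 2)).indicator 1 v := by
    intro v
    by_cases hv : (Prod.mk v ⁻¹' Red).Nonempty
    · obtain ⟨w, hw⟩ := hv
      have hb := (red_bound hw).1
      have hpos : 0 < v.1 ^ 2 + v.2 ^ 2 := by
        rcases (by positivity : 0 ≤ v.1 ^ 2 + v.2 ^ 2).eq_or_lt with h | h
        · have h1 : v.1 = 0 := by nlinarith [sq_nonneg v.1, sq_nonneg v.2]
          have h2 : v.2 = 0 := by nlinarith [sq_nonneg v.1, sq_nonneg v.2]
          have := hw.1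
          simp [cdet, h1, h2] at this
        · exact h
      have hle : v.1 ^ 2 + v.2 ^ 2 ≤ 4 := by
        have h1 := hw.1
        have h2 := hw.2.1
        simp only at hb
        nlinarith
      have hmem : v ∈ Set.Icc ((-2, -2) : ℝ × ℝ) (2, 2) := by
        constructor <;> constructor <;> simp only <;> nlinarith [sq_nonneg v.1, sq_nonneg v.2]
      rw [Set.indicator_of_mem hmem]
      let L : (ℝ × ℝ) →ₗ[ℝ] (ℝ × ℝ) := Matrix.toLin (Module.Basis.finTwoProd ℝ)
        (Module.Basis.finTwoProd ℝ) !![v.1, v.2; -v.2, v.1]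
      have hL : ∀ w, L w = (v.1 * w.1 + v.2 * w.2, -v.2 * w.1 + v.1 * w.2) := fun w => by
        simp only [L]; rw [Matrix.toLin_finTwoProd_apply]
      have hd : LinearMap.det L = v.1 ^ 2 + v.2 ^ 2 := by
        simp only [L]; rw [LinearMap.det_toLin, Matrix.det_fin_two_of]; ring
      have hsub : Prod.mk v ⁻¹' Red ⊆ L ⁻¹' (Set.Icc (-((v.1 ^ 2 + v.2 ^ 2) / 2))
          ((v.1 ^ 2 + v.2 ^ 2) / 2) ×ˢ Set.Icc 0 1) := by
        rintro w ⟨h1, h2, h3, h4⟩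
        have h5 := abs_le.1 (by linarith : |v.1 * w.1 + v.2 * w.2| ≤ (v.1 ^ 2 + v.2 ^ 2) / 2)
        simp only [cdet] at h1 h2
        simp only [Set.mem_preimage, hL, Set.mem_prod, Set.mem_Icc]
        refine ⟨⟨h5.1, h5.2⟩, ?_, ?_⟩ <;> linarith
      refine (measure_mono hsub).trans ?_
      rw [Measure.addHaar_preimage_linearMap _ (by rw [hd]; exact hpos.ne'), hd,
        Measure.volume_eq_prod, Measure.prod_prod, Real.volume_Icc, Real.volume_Icc,
        ← ENNReal.ofReal_mul (by linarith), ← ENNReal.ofReal_mul (by positivity),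
        abs_of_pos (inv_pos.2 hpos)]
      simp only [Pi.one_apply]
      rw [← ENNReal.ofReal_one]
      apply ENNReal.ofReal_le_ofReal
      field_simp
      norm_num
    · rw [Set.not_nonempty_iff_eq_empty.1 hv]; simp
  rw [Measure.volume_eq_prod, Measure.prod_apply measurableSet_Red]
  refine (lintegral_mono hs).trans_lt ?_
  rw [lintegral_indicator measurableSet_Icc]
  simp only [Pi.one_apply, lintegral_one, Measure.restrict_apply_univ]
  exact isCompact_Icc.measure_lt_top

theorem abs_le_of_sq_add_sq_le {a b : ℤ} {n : ℕ} {C : ℝ} (h : (a : ℝ) ^ 2 + (b : ℝ) ^ 2 ≤ C)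
    (hn : C < n) : |a| ≤ (n : ℤ) ∧ |b| ≤ (n : ℤ) := by
  have h3 : a ^ 2 + b ^ 2 < (n : ℤ) := by exact_mod_cast h.trans_lt hn
  have ha : |a| ≤ a ^ 2 := by
    rcases eq_or_ne a 0 with rfl | h0
    · simp
    · rw [← sq_abs]; nlinarith [Int.one_le_abs h0]
  have hb : |b| ≤ b ^ 2 := by
    rcases eq_or_ne b 0 with rfl | h0
    · simp
    · rw [← sq_abs]; nlinarith [Int.one_le_abs h0]
  constructor <;> linarith [sq_nonneg a, sq_nonneg b]

theorem cramer_bound {x : Cols} (p r : ℝ) :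
    cdet x ^ 2 * (p ^ 2 + r ^ 2) ≤ ((p • x.1 + r • x.2).1 ^ 2 + (p • x.1 + r • x.2).2 ^ 2) *
      (x.1.1 ^ 2 + x.1.2 ^ 2 + (x.2.1 ^ 2 + x.2.2 ^ 2)) := by
  simp only [cdet, Prod.fst_add, Prod.snd_add, Prod.smul_fst, Prod.smul_snd, smul_eq_mul]
  nlinarith [sq_nonneg ((p * x.1.1 + r * x.2.1) * x.1.1 + (p * x.1.2 + r * x.2.2) * x.1.2),
    sq_nonneg ((p * x.1.1 + r * x.2.1) * x.2.1 + (p * x.1.2 + r * x.2.2) * x.2.2)]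

theorem one_le_sq_add_sq (γ : SL(2, ℤ)) : (1 : ℝ) ≤ (γ 0 0 : ℝ) ^ 2 + (γ 1 0 : ℝ) ^ 2 := by
  have hdet : γ 0 0 * γ 1 1 - γ 0 1 * γ 1 0 = 1 := by
    have := γ.2
    rwa [Matrix.det_fin_two] at this
  have : 1 ≤ γ 0 0 ^ 2 + γ 1 0 ^ 2 := by
    by_contra hc
    have h0 : γ 0 0 = 0 := by
      have : γ 0 0 ^ 2 = 0 := by linarith [sq_nonneg (γ 0 0), sq_nonneg (γ 1 0)]
      simpa using this
    have h1 : γ 1 0 = 0 := by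
      have : γ 1 0 ^ 2 = 0 := by linarith [sq_nonneg (γ 0 0), sq_nonneg (γ 1 0)]
      simpa using this
    simp [h0, h1] at hdet
  exact_mod_cast this

theorem size_bound {D K P Q : ℝ} (hD : 0 < D) (hK : 0 ≤ K) (hP : 0 ≤ P)
    (b1 : 3 * P ^ 2 ≤ 4 * D ^ 2) (b2 : 4 * (P * Q) ≤ P ^ 2 + 4 * D ^ 2) (h : D ^ 2 ≤ P * K) :
    P ≤ D + (D + 4 * K) ∧ Q ≤ D + (D + 4 * K) := by
  have hD2 : 0 < D ^ 2 := by positivity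
  have hPpos : 0 < P := by
    rcases hP.eq_or_lt with h0 | h0
    · rw [← h0] at h; linarith
    · exact h0
  have hP2 : P ≤ 2 * D := by nlinarith
  have : P * (4 * Q) ≤ P * (P + 4 * K) := by nlinarith
  have := le_of_mul_le_mul_left this hPpos
  constructor <;> linarith

theorem finite_rmul_mem_Red {x : Cols} (h : 0 < cdet x) : {γ | rmul γ x ∈ Red}.Finite := by
  obtain ⟨K, hK⟩ : ∃ K, K = x.1.1 ^ 2 + x.1.2 ^ 2 + (x.2.1 ^ 2 + x.2.2 ^ 2) := ⟨_, rfl⟩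
  have hK0 : 0 ≤ K := by rw [hK]; positivity
  obtain ⟨n, hn⟩ := exists_nat_gt ((cdet x + (cdet x + 4 * K)) * K / cdet x ^ 2)
  have hD2 : 0 < cdet x ^ 2 := by positivity
  have key : ∀ γ, rmul γ x ∈ Red → ∀ i j, |γ i j| ≤ (n : ℤ) := by
    intro γ hγ
    obtain ⟨b1, b2⟩ := red_bound hγ
    rw [cdet_rmul] at b1 b2
    have c1 := cramer_bound (x := x) (γ 0 0 : ℝ) (γ 1 0 : ℝ)
    have c2 := cramer_bound (x := x) (γ 0 1 : ℝ) (γ 1 1 : ℝ)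
    change 3 * (((γ 0 0 : ℝ) • x.1 + (γ 1 0 : ℝ) • x.2).1 ^ 2 + _) ^ 2 ≤ _ at b1
    rw [← hK] at c1 c2
    have hl : cdet x ^ 2 ≤ cdet x ^ 2 * ((γ 0 0 : ℝ) ^ 2 + (γ 1 0 : ℝ) ^ 2) :=
      le_mul_of_one_le_right hD2.le (one_le_sq_add_sq γ)
    obtain ⟨s1, s2⟩ := size_bound h hK0 (by positivity) b1 b2 (hl.trans c1)
    have d1 := abs_le_of_sq_add_sq_le ((le_div_iff₀ hD2).2 ((mul_comm _ _).trans_le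
      (c1.trans (mul_le_mul_of_nonneg_right s1 hK0)))) hn
    have d2 := abs_le_of_sq_add_sq_le ((le_div_iff₀ hD2).2 ((mul_comm _ _).trans_le
      (c2.trans (mul_le_mul_of_nonneg_right s2 hK0)))) hn
    intro i j
    fin_cases i <;> fin_cases j
    exacts [d1.1, d2.1, d1.2, d2.2]
  have hfin : (Set.Icc (fun _ _ => -(n : ℤ) : Fin 2 → Fin 2 → ℤ) (fun _ _ => (n : ℤ))).Finite :=
    Set.finite_Icc _ _
  refine (hfin.preimage (f := fun γ : SL(2, ℤ) => (fun i j => γ i j : Fin 2 → Fin 2 → ℤ))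
    ?_).subset ?_
  · intro a _ b _ hab
    apply Subtype.ext
    ext i j
    exact congrFun (congrFun hab i) j
  · intro γ hγ
    exact ⟨fun i j => (abs_le.1 (key γ hγ i j)).1, fun i j => (abs_le.1 (key γ hγ i j)).2⟩

theorem exists_rmul_mem_Red {x : Cols} (h : 0 < cdet x) (h1 : cdet x ≤ 1) :
    ∃ γ, rmul γ x ∈ Red := by
  have hA0 : (⟨x.1.1, -x.1.2⟩ : ℂ) ≠ 0 := by
    intro h0
    have a1 : x.1.1 = 0 := congrArg Complex.re h0
    have a2 : -x.1.2 = 0 := congrArg Complex.im h0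
    simp only [cdet] at h
    rw [a1, neg_eq_zero.1 a2] at h
    simp at h
  have him : 0 < ((⟨-x.2.1, x.2.2⟩ : ℂ) / ⟨x.1.1, -x.1.2⟩).im := by
    have hn := Complex.normSq_pos.2 hA0
    rw [Complex.div_im, ← sub_div]
    apply div_pos _ hn
    simp only [cdet] at h
    simp only
    linarith
  obtain ⟨g, hg⟩ := ModularGroup.exists_smul_mem_fd
    ⟨(⟨-x.2.1, x.2.2⟩ : ℂ) / ⟨x.1.1, -x.1.2⟩, him⟩
  refine ⟨g⁻¹, by rwa [cdet_rmul], by rwa [cdet_rmul], ?_⟩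
  set y := rmul g⁻¹ x with hy
  have hyd : 0 < cdet y := by rw [hy, cdet_rmul]; exact h
  have hA1 : (⟨y.1.1, -y.1.2⟩ : ℂ) ≠ 0 := by
    intro h0
    have a1 : y.1.1 = 0 := congrArg Complex.re h0
    have a2 : -y.1.2 = 0 := congrArg Complex.im h0
    simp only [cdet] at hyd
    rw [a1, neg_eq_zero.1 a2] at hyd
    simp at hyd
  have hcoe : ((g • (⟨(⟨-x.2.1, x.2.2⟩ : ℂ) / ⟨x.1.1, -x.1.2⟩, him⟩ : UpperHalfPlane) :
      UpperHalfPlane) : ℂ) = ⟨-y.2.1, y.2.2⟩ / ⟨y.1.1, -y.1.2⟩ := by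
    rw [UpperHalfPlane.specialLinearGroup_apply]
    have hi : ∀ i j, g⁻¹ i j = (Matrix.adjugate (g : Matrix (Fin 2) (Fin 2) ℤ)) i j := by
      intro i j; rw [Matrix.SpecialLinearGroup.coe_inv]
    have n1 : (⟨-y.2.1, y.2.2⟩ : ℂ) =
        (g 0 0 : ℂ) * ⟨-x.2.1, x.2.2⟩ + (g 0 1 : ℂ) * ⟨x.1.1, -x.1.2⟩ := by
      simp only [hy, rmul, hi, Matrix.adjugate_fin_two]
      apply Complex.ext <;> simp <;> ring
    have n2 : (⟨y.1.1, -y.1.2⟩ : ℂ) =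
        (g 1 0 : ℂ) * ⟨-x.2.1, x.2.2⟩ + (g 1 1 : ℂ) * ⟨x.1.1, -x.1.2⟩ := by
      simp only [hy, rmul, hi, Matrix.adjugate_fin_two]
      apply Complex.ext <;> simp <;> ring
    rw [n1, n2]
    have e : ∀ A B a b c d : ℂ, A ≠ 0 →
        (a * (B / A) + b) / (c * (B / A) + d) = (a * B + b * A) / (c * B + d * A) := by
      intro A B a b c d hA
      rw [← mul_div_mul_right _ _ hA]
      congr 1 <;> field_simp
    have := e _ (⟨-x.2.1, x.2.2⟩ : ℂ) (g 0 0) (g 0 1) (g 1 0) (g 1 1) hA0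
    rw [← this]
    simp
  have hn := Complex.normSq_pos.2 hA1
  obtain ⟨f1, f2⟩ := hg
  rw [hcoe, Complex.normSq_div, le_div_iff₀ hn] at f1
  rw [← UpperHalfPlane.coe_re, hcoe, Complex.div_re, ← add_div, abs_div, abs_of_pos hn,
    div_le_iff₀ hn] at f2
  simp only [Complex.normSq_mk] at f1 f2
  refine ⟨by nlinarith, ?_⟩
  have : |y.1.1 * y.2.1 + y.1.2 * y.2.2| = |-y.2.1 * y.1.1 + y.2.2 * -y.1.2| := by
    rw [← abs_neg]; congr 1; ring
  rw [this]
  nlinarith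

instance : Countable SL(2, ℤ) := by
  have : Function.Injective (fun γ : SL(2, ℤ) => (fun i j => γ i j : Fin 2 → Fin 2 → ℤ)) := by
    intro a b hab
    apply Subtype.ext
    ext i j
    exact congrFun (congrFun hab i) j
  exact this.countable

/-- The number of points of a right `SL₂(ℤ)`-orbit in `Red`. -/
noncomputable def mult (x : Cols) : ℝ≥0∞ := ∑' γ : SL(2, ℤ), Red.indicator 1 (rmul γ x)

/-- The weight `1 / mult` on `Red`; its sum over each orbit with determinant in `(0, 1]` is one. -/
noncomputable def weight (x : Cols) : ℝ≥0∞ := Red.indicator 1 x * (mult x)⁻¹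

theorem measurable_rmul (γ : SL(2, ℤ)) : Measurable (rmul γ) := (mp_rmul γ).measurable

theorem measurable_weight : Measurable weight := by
  have h : Measurable (Red.indicator (1 : Cols → ℝ≥0∞)) :=
    measurable_one.indicator measurableSet_Red
  exact h.mul (Measurable.tsum fun γ => h.comp (measurable_rmul γ)).inv

theorem mult_rmul (γ : SL(2, ℤ)) (x : Cols) : mult (rmul γ x) = mult x := by
  unfold mult
  simp only [← rmul_mul]
  exact (Equiv.mulLeft γ).tsum_eq (fun δ => Red.indicator (1 : Cols → ℝ≥0∞) (rmul δ x))

theorem tsum_weight {x : Cols} (h : 0 < cdet x) (h1 : cdet x ≤ 1) :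
    ∑' γ, weight (rmul γ x) = 1 := by
  simp only [weight, mult_rmul]
  rw [ENNReal.tsum_mul_right]
  change mult x * (mult x)⁻¹ = 1
  apply ENNReal.mul_inv_cancel
  · obtain ⟨γ, hγ⟩ := exists_rmul_mem_Red h h1
    intro h0
    have := ENNReal.tsum_eq_zero.1 h0 γ
    simp [hγ] at this
  · have hf := finite_rmul_mem_Red h
    unfold mult
    rw [tsum_eq_sum (s := hf.toFinset) (fun γ hγ => by
      rw [Set.indicator_of_notMem]; simpa using hγ)]
    refine (ENNReal.sum_lt_top.2 fun γ _ => ?_).ne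
    exact (Set.indicator_le_self' (f := (1 : Cols → ℝ≥0∞)) (by simp) _).trans_lt
      ENNReal.one_lt_top

theorem lintegral_unfold {u F : Cols → ℝ≥0∞} (hu : Measurable u) (hF : Measurable F)
    (hFD : ∀ x, F x ≠ 0 → 0 < cdet x ∧ cdet x ≤ 1) (hFi : ∀ γ x, F (rmul γ x) = F x)
    (hsum : ∀ x, 0 < cdet x → cdet x ≤ 1 → ∑' γ, u (rmul γ x) = 1) :
    ∫⁻ x, u x * F x = ∫⁻ x, weight x * F x := by
  have hw := measurable_weight
  calc ∫⁻ x, u x * F x = ∫⁻ x, ∑' γ, u x * F x * weight (rmul γ x) := by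
        refine lintegral_congr fun x => ?_
        rw [ENNReal.tsum_mul_left]
        by_cases hx : F x = 0
        · simp [hx]
        · rw [tsum_weight (hFD x hx).1 (hFD x hx).2, mul_one]
    _ = ∑' γ, ∫⁻ x, u x * F x * weight (rmul γ x) :=
        lintegral_tsum fun γ =>
          ((hu.mul hF).mul (hw.comp (measurable_rmul γ))).aemeasurable
    _ = ∑' γ, ∫⁻ x, u (rmul γ⁻¹ x) * F x * weight x := by
        refine tsum_congr fun γ => ?_
        refine Eq.trans ?_ ((mp_rmul γ).lintegral_comp
          (((hu.comp (measurable_rmul γ⁻¹)).mul hF).mul hw))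
        refine lintegral_congr fun x => ?_
        change _ = u (rmul γ⁻¹ (rmul γ x)) * F (rmul γ x) * weight (rmul γ x)
        rw [← rmul_mul, mul_inv_cancel, rmul_one, hFi]
    _ = ∫⁻ x, ∑' γ : SL(2, ℤ), u (rmul γ⁻¹ x) * F x * weight x :=
        (lintegral_tsum fun γ =>
          (((hu.comp (measurable_rmul γ⁻¹)).mul hF).mul hw).aemeasurable).symm
    _ = ∫⁻ x, weight x * F x := by
        refine lintegral_congr fun x => ?_
        simp only [mul_assoc]
        rw [ENNReal.tsum_mul_right]
        by_cases hx : F x = 0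
        · simp [hx]
        · have hi : ∑' γ : SL(2, ℤ), u (rmul γ⁻¹ x) = ∑' γ, u (rmul γ x) :=
            (Equiv.inv SL(2, ℤ)).tsum_eq (fun γ => u (rmul γ x))
          rw [hi, hsum x (hFD x hx).1 (hFD x hx).2, one_mul, mul_comm]

/-- The cone measure on `X`: Lebesgue measure of the matrices `A` with `0 < det A ≤ 1`, counted once
in each `SL₂(ℤ)`-orbit (through `weight`), pushed to `X` by `A ↦ [A / √(det A)]`. -/
noncomputable def preHaar : Measure X := (volume.withDensity weight).map toX

theorem preHaar_apply {B : Set X} (hB : MeasurableSet B) :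
    preHaar B = ∫⁻ x, weight x * (toX ⁻¹' B).indicator 1 x := by
  rw [preHaar, Measure.map_apply measurable_toX hB, withDensity_apply _ (measurable_toX hB),
    ← lintegral_indicator (measurable_toX hB)]
  refine lintegral_congr fun x => ?_
  by_cases hx : x ∈ toX ⁻¹' B <;> simp [hx]

theorem weight_ne_zero {x : Cols} (h : weight x ≠ 0) : 0 < cdet x ∧ cdet x ≤ 1 := by
  by_cases hx : x ∈ Red
  · exact ⟨hx.1, hx.2.1⟩
  · simp [weight, hx] at h

theorem measurableSet_D : MeasurableSet {x | 0 < cdet x ∧ cdet x ≤ 1} :=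
  (measurableSet_lt measurable_const continuous_cdet.measurable).inter
    (measurableSet_le continuous_cdet.measurable measurable_const)

theorem measurable_smul_X (g : SL(2, ℝ)) : Measurable (fun x : X => g • x) :=
  (continuous_const_smul g).measurable

theorem indicator_one_congr {α β : Type*} {s : Set α} {t : Set β} {x : α} {y : β}
    (h : x ∈ s ↔ y ∈ t) : s.indicator (1 : α → ℝ≥0∞) x = t.indicator 1 y := by
  by_cases hx : x ∈ s
  · rw [Set.indicator_of_mem hx, Set.indicator_of_mem (h.1 hx)]; rfl
  · rw [Set.indicator_of_notMem hx, Set.indicator_of_notMem (mt h.2 hx)]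

theorem preHaar_map (g : SL(2, ℝ)) : preHaar.map (fun x => g • x) = preHaar := by
  ext B hB
  rw [Measure.map_apply (measurable_smul_X g) hB,
    preHaar_apply (measurable_smul_X g hB), preHaar_apply hB]
  set F : Cols → ℝ≥0∞ := ({x | 0 < cdet x ∧ cdet x ≤ 1} ∩ toX ⁻¹' B).indicator 1 with hF
  have hFm : Measurable F := measurable_one.indicator (measurableSet_D.inter (measurable_toX hB))
  have hFD : ∀ x, F x ≠ 0 → 0 < cdet x ∧ cdet x ≤ 1 := fun x hx =>
    (Set.mem_of_indicator_ne_zero hx).1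
  have hFi : ∀ γ x, F (rmul γ x) = F x := by
    intro γ x
    refine indicator_one_congr ⟨fun h => ⟨?_, ?_⟩, fun h => ⟨?_, ?_⟩⟩
    · have := h.1; rwa [Set.mem_ofPred_eq, cdet_rmul] at this
    · have := h.1; rw [Set.mem_ofPred_eq, cdet_rmul] at this
      have h2 : toX (rmul γ x) ∈ B := h.2
      rwa [toX_rmul γ this.1] at h2
    · rw [Set.mem_ofPred_eq, cdet_rmul]; exact h.1
    · change toX (rmul γ x) ∈ B
      rw [toX_rmul γ h.1.1]; exact h.2
  have hwm := measurable_weight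
  have hlm : ∀ g, Measurable (lmul g) := fun g => (mp_lmul g).measurable
  calc _ = ∫⁻ x, weight x * F (lmul g x) := by
        refine lintegral_congr fun x => ?_
        by_cases hx : weight x = 0
        · simp [hx]
        · have hD := weight_ne_zero hx
          congr 1
          refine indicator_one_congr ⟨fun h => ⟨?_, ?_⟩, fun h => ?_⟩
          · rw [Set.mem_ofPred_eq, cdet_lmul]; exact hD
          · change toX (lmul g x) ∈ B
            rw [toX_lmul g hD.1]; exact h
          · have h2 : toX (lmul g x) ∈ B := h.2
            rw [toX_lmul g hD.1] at h2; exact h2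
    _ = ∫⁻ x, weight (lmul g⁻¹ x) * F x := by
        refine Eq.trans ?_ ((mp_lmul g).lintegral_comp ((hwm.comp (hlm g⁻¹)).mul hFm))
        refine lintegral_congr fun x => ?_
        change _ = weight (lmul g⁻¹ (lmul g x)) * F (lmul g x)
        rw [← lmul_mul, inv_mul_cancel, lmul_one]
    _ = ∫⁻ x, weight x * F x := by
        refine lintegral_unfold (hwm.comp (hlm g⁻¹)) hFm hFD hFi fun x h h1 => ?_
        simp only [lmul_rmul]
        exact tsum_weight (by rwa [cdet_lmul]) (by rwa [cdet_lmul])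
    _ = _ := by
        refine lintegral_congr fun x => ?_
        by_cases hx : weight x = 0
        · simp [hx]
        · have hD := weight_ne_zero hx
          congr 1
          exact indicator_one_congr ⟨fun h => h.2, fun h => ⟨hD, h⟩⟩

theorem preHaar_univ : preHaar Set.univ = ∫⁻ x, weight x := by
  rw [preHaar_apply MeasurableSet.univ]; simp

theorem preHaar_univ_ne_top : preHaar Set.univ ≠ ∞ := by
  rw [preHaar_univ]
  refine ((lintegral_mono (g := Red.indicator 1) fun x => ?_).trans_lt ?_).ne
  · by_cases hx : x ∈ Red
    · have : 1 ≤ mult x := by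
        refine le_trans ?_ (ENNReal.le_tsum (1 : SL(2, ℤ)))
        simp [rmul_one, hx]
      simpa [weight, hx] using this
    · simp [weight, hx]
  · rw [lintegral_indicator_one measurableSet_Red]
    exact volume_Red_lt_top

theorem preHaar_univ_ne_zero : preHaar Set.univ ≠ 0 := by
  rw [preHaar_univ]
  intro h0
  rw [lintegral_eq_zero_iff measurable_weight] at h0
  have h1 : ∀ᵐ x : Cols, ∀ γ, weight (rmul γ x) = 0 :=
    ae_all_iff.2 fun γ => (mp_rmul γ).quasiMeasurePreserving.ae h0
  have h2 : volume {x : Cols | 0 < cdet x ∧ cdet x < 1} = 0 := by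
    refine measure_mono_null (fun x hx => ?_) (ae_iff.1 h1)
    intro h
    have := tsum_weight hx.1 hx.2.le
    simp [h] at this
  have ho : IsOpen {x : Cols | 0 < cdet x ∧ cdet x < 1} :=
    (isOpen_lt continuous_const continuous_cdet).inter
      (isOpen_lt continuous_cdet continuous_const)
  have := (ho.measure_eq_zero_iff volume).1 h2
  have hm : (((1, 0), (0, 1 / 2)) : Cols) ∈ {x : Cols | 0 < cdet x ∧ cdet x < 1} := by
    simp [cdet]; norm_num
  rw [this] at hm
  exact hm

/-- The Haar probability measure `μ_X` on `X = SL₂(ℝ)/SL₂(ℤ)`: the cone measure `preHaar`, scaled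
to total mass one. By `isHaarProbability_haarX` it is a Borel probability measure invariant under
left translation by `SL₂(ℝ)`, and these properties characterise `μ_X`. -/
noncomputable def haarX : Measure X := (preHaar Set.univ)⁻¹ • preHaar

theorem isHaarProbability_haarX : IsHaarProbability haarX := by
  refine ⟨⟨?_⟩, fun g => ?_⟩
  · rw [haarX, Measure.smul_apply, smul_eq_mul,
      ENNReal.inv_mul_cancel preHaar_univ_ne_zero preHaar_univ_ne_top]
  · rw [haarX, Measure.map_smul, preHaar_map]

/-- The diagonal flow `a_t = diag(e^{t/2}, e^{-t/2})`. -/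
noncomputable def flow (t : ℝ) : SL(2, ℝ) :=
  ⟨!![Real.exp (t / 2), 0; 0, Real.exp (-(t / 2))], by
    rw [Matrix.det_fin_two_of, ← Real.exp_add]; simp⟩

/-- A measure on `X` is `a_t`-invariant if it is invariant under `x ↦ a_t x` for every real `t`. -/
def FlowInvariant (μ : Measure X) : Prop :=
  ∀ t : ℝ, μ.map (fun x => flow t • x) = μ

/-- The average of a finite set of probability measures (the zero measure for the empty set). -/
noncomputable def avg (Ω : Finset (ProbabilityMeasure X)) : Measure X :=
  (Ω.card : ℝ≥0∞)⁻¹ • ∑ ν ∈ Ω, (ν : Measure X)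

theorem avg_empty : avg ∅ = 0 := by simp [avg]

/-- Weak* convergence, tested on compactly supported continuous functions. Mass may escape, so
the limit of probability measures need not be a probability measure. -/
def WeakStarTendsto (ν : ℕ → Measure X) (μ : Measure X) : Prop :=
  ∀ f : C_c(X, ℝ), Tendsto (fun q => ∫ x, f x ∂(ν q)) atTop (𝓝 (∫ x, f x ∂μ))

/-- `μ` is a weak* limit point of the sequence `ν`: a finite Borel measure to which some
subsequence of `ν` converges. -/
def IsWeakStarLimitPoint (ν : ℕ → Measure X) (μ : Measure X) : Prop :=
  IsFiniteMeasure μ ∧ ∃ φ : ℕ → ℕ, StrictMono φ ∧ WeakStarTendsto (fun k => ν (φ k)) μ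

/-- A sequence of finite sets of probability measures is uniformly almost invariant if, for any
choice of non-empty subsets, every weak* limit point of their averages is `a_t`-invariant. -/
def UniformlyAlmostInvariant (Ω : ℕ → Finset (ProbabilityMeasure X)) : Prop :=
  ∀ Ω' : ℕ → Finset (ProbabilityMeasure X), (∀ q, Ω' q ⊆ Ω q) → (∀ q, (Ω' q).Nonempty) →
    ∀ μ : Measure X, IsWeakStarLimitPoint (fun q => avg (Ω' q)) μ → FlowInvariant μ

end LatticeSpace

/-! The measure `haarX` is ergodic for the flow, hence extreme among the invariant probability
measures, and an extreme point cannot be the limit of averages of which a positive proportion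
behaves differently. Fix `f` in `C_c` and `ε > 0`, and suppose that along a subsequence a proportion
at least `δ` of `Ω q` consists of measures whose integral of `f` exceeds that of `haarX` by `ε`. By
vague compactness (`exists_subseq_tendsto_integral`) the averages over these subsets have a limit
point `μ`, which is flow invariant by uniform almost invariance. Comparing averages over a subset
and over the whole set gives `μ ≤ δ⁻¹ • haarX`, so `μ` is absolutely continuous and ergodicity makes
it a multiple of `haarX`. The same comparison applied to `1 - f` shows that no mass escapes. Thus `μ
= haarX` (`eq_haarX_of_tendsto_avg`), which contradicts the excess `ε`.

Ergodicity (`FlowInvariant.eq_smul_haarX`) comes from Mautner's phenomenon: translation is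
continuous in `L¹`, and conjugation by the flow contracts unipotents to the identity, so the density
of `μ` is invariant under unipotents, hence under all of `SL(2, ℝ)`. Fubini then makes it constant.

The bad proportion thus tends to zero for each single test function. A diagonal choice over a
countable dense family in `C_c` yields one sequence of subsets that serves all test functions. -/

/-! ### Vague convergence of measures on locally compact second countable spaces -/

section VagueTopology

variable {Y : Type*} [TopologicalSpace Y]

/-- A uniformly dense sequence of compactly supported functions on a locally compact second
countable space. -/
theorem CompactlySupportedContinuousMap.exists_seq_dense [T2Space Y] [LocallyCompactSpace Y]
    [SecondCountableTopology Y] :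
    ∃ u : ℕ → C_c(Y, ℝ), ∀ f : C_c(Y, ℝ), ∀ ε > 0, ∃ n, ∀ x, |f x - u n x| < ε := by
  let K := CompactExhaustion.choice Y
  let S : ℕ → Set C_c(Y, ℝ) := fun n => {f | ∀ x ∉ K n, f x = 0}
  let r : (n : ℕ) → C_c(Y, ℝ) → C(K n, ℝ) := fun n f => f.toContinuousMap.restrict (K n)
  have hS : ∀ n, ∃ D : Set C_c(Y, ℝ), D.Countable ∧ D ⊆ S n ∧
      ∀ f ∈ S n, ∀ ε > 0, ∃ g ∈ D, ∀ x, |f x - g x| < ε := by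
    intro n
    have : CompactSpace (K n) := isCompact_iff_compactSpace.1 (K.isCompact n)
    -- The dense set is taken inside the image of `S n`, not merely in `C(K n, ℝ)`: the approximants
    -- then vanish off `K n`, and closeness on `K n` is closeness everywhere.
    have hsep : TopologicalSpace.IsSeparable (r n '' S n) :=
      TopologicalSpace.IsSeparable.of_separableSpace _
    obtain ⟨c, hcs, hc, hd⟩ := hsep.exists_countable_dense_subset
    obtain ⟨D, hDS, hDc, hDi⟩ : ∃ D ⊆ S n, D.Countable ∧ r n '' D = c := by
      obtain ⟨D, hD, hb⟩ := (Set.surjOn_image (r n) (S n)).mono subset_rfl hcs |>.exists_bijOn_subset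
      exact ⟨D, hD, Set.countable_of_injective_of_countable_image hb.injOn (hb.image_eq ▸ hc), hb.image_eq⟩
    refine ⟨D, hDc, hDS, fun f hf ε hε => ?_⟩
    obtain ⟨_, hgc, hfg⟩ := Metric.mem_closure_iff.1 (hd (Set.mem_image_of_mem (r n) hf)) ε hε
    rw [← hDi] at hgc
    obtain ⟨g, hg, rfl⟩ := hgc
    refine ⟨g, hg, fun x => ?_⟩
    by_cases hx : x ∈ K n
    · exact (ContinuousMap.dist_apply_le_dist (f := r n f) (g := r n g) ⟨x, hx⟩).trans_lt hfg
    · rw [hf x hx, hDS hg x hx]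
      simpa using hε
  choose D hDc hDS hD using hS
  have hne : (⋃ n, D n).Nonempty := by
    obtain ⟨g, hg, -⟩ := hD 0 0 (fun _ _ => rfl) 1 one_pos
    exact ⟨g, Set.mem_iUnion.2 ⟨0, hg⟩⟩
  obtain ⟨u, hu⟩ := (Set.countable_iUnion hDc).exists_eq_range hne
  refine ⟨u, fun f ε hε => ?_⟩
  obtain ⟨n, hn⟩ := K.exists_superset_of_isCompact f.hasCompactSupport
  obtain ⟨g, hg, hfg⟩ := hD n f
    (fun x hx => image_eq_zero_of_notMem_tsupport fun h => hx (hn h)) ε hε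
  obtain ⟨m, rfl⟩ : g ∈ Set.range u := hu ▸ Set.mem_iUnion.2 ⟨n, hg⟩
  exact ⟨m, hfg⟩

theorem exists_compactlySupported_one_on [T2Space Y] [LocallyCompactSpace Y] {K : Set Y}
    (hK : IsCompact K) : ∃ f : C_c(Y, ℝ), (∀ x ∈ K, f x = 1) ∧ ∀ x, f x ∈ Set.Icc 0 1 := by
  obtain ⟨f, h1, -, h2, h3⟩ := exists_continuous_one_zero_of_isCompact hK isClosed_empty
    (Set.disjoint_empty K)
  exact ⟨⟨f, h2⟩, h1, h3⟩

variable [MeasurableSpace Y] [BorelSpace Y]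

theorem abs_integral_sub_le_of_abs_sub_le [T2Space Y] {μ : Measure Y} [IsFiniteMeasure μ]
    (hμ : μ Set.univ ≤ 1) {f g : C_c(Y, ℝ)} {ε : ℝ} (h : ∀ x, |f x - g x| ≤ ε) (hε : 0 ≤ ε) :
    |∫ x, f x ∂μ - ∫ x, g x ∂μ| ≤ ε := by
  rw [← integral_sub f.integrable g.integrable, ← Real.norm_eq_abs]
  refine (norm_integral_le_of_norm_le_const (Eventually.of_forall h)).trans ?_
  refine mul_le_of_le_one_right hε ?_
  exact ENNReal.toReal_le_of_le_ofReal zero_le_one (by simpa using hμ)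

theorem measureReal_le_integral_of_one_on [T2Space Y] {μ : Measure Y}
    [IsFiniteMeasureOnCompacts μ]
    {K : Set Y} (hK : IsCompact K) {f : C_c(Y, ℝ)} (h1 : ∀ x ∈ K, f x = 1) (h0 : ∀ x, 0 ≤ f x) :
    μ.real K ≤ ∫ x, f x ∂μ := by
  rw [← integral_indicator_one hK.measurableSet]
  refine integral_mono ?_ f.integrable fun x => ?_
  · exact (continuousOn_const.integrableOn_compact hK).integrable_indicator hK.measurableSet
  · by_cases hx : x ∈ K
    · simp [hx, h1 x hx]
    · simp [hx, h0 x]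

variable [T2Space Y] [LocallyCompactSpace Y] [SecondCountableTopology Y]

/-- Inner regularity reduces the bound to compact sets, each dominated by a test function with
values in `[0, 1]`. -/
theorem measure_univ_le_of_integral_le {μ : Measure Y} [IsLocallyFiniteMeasure μ] {C : ℝ}
    (h : ∀ f : C_c(Y, ℝ), (∀ x, f x ∈ Set.Icc 0 1) → ∫ x, f x ∂μ ≤ C) :
    μ Set.univ ≤ ENNReal.ofReal C := by
  rw [isOpen_univ.measure_eq_iSup_isCompact]
  refine iSup₂_le fun K _ => iSup_le fun hK => ?_
  obtain ⟨f, h1, h2⟩ := exists_compactlySupported_one_on hK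
  have h3 := (measureReal_le_integral_of_one_on (μ := μ) hK h1 fun x => (h2 x).1).trans (h f h2)
  rw [← ENNReal.ofReal_toReal hK.measure_lt_top.ne]
  exact ENNReal.ofReal_le_ofReal h3

/-- The difference of the two integrals is a positive functional on `C_c`, so it has a Riesz
measure. Uniqueness of the representing measure shows that `ν` is `μ` plus this measure. -/
theorem measure_le_of_integral_le {μ ν : Measure Y} [IsFiniteMeasure μ] [IsFiniteMeasure ν]
    (h : ∀ f : C_c(Y, ℝ), (∀ x, 0 ≤ f x) → ∫ x, f x ∂μ ≤ ∫ x, f x ∂ν) : μ ≤ ν := by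
  let Λ : C_c(Y, ℝ) →ₚ[ℝ] ℝ := PositiveLinearMap.mk₀
    { toFun := fun f => ∫ x, f x ∂ν - ∫ x, f x ∂μ
      map_add' := fun f g => by
        simp only [CompactlySupportedContinuousMap.add_apply]
        rw [integral_add f.integrable g.integrable, integral_add f.integrable g.integrable]
        ring
      map_smul' := fun c f => by
        simp only [CompactlySupportedContinuousMap.smul_apply, smul_eq_mul, integral_const_mul,
          RingHom.id_apply]
        ring }
    (fun f hf => sub_nonneg.2 (h f hf))
  have hν : ν = μ + RealRMK.rieszMeasure Λ := by
    have : IsLocallyFiniteMeasure (μ + RealRMK.rieszMeasure Λ) :=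
      ⟨fun x => by
        obtain ⟨K, hK, hx⟩ := exists_compact_mem_nhds x
        exact ⟨K, hx, by simpa using hK.measure_lt_top (μ := RealRMK.rieszMeasure Λ)⟩⟩
    refine Measure.ext_of_integral_eq_on_compactlySupported fun f => ?_
    rw [integral_add_measure f.integrable f.integrable, RealRMK.integral_rieszMeasure]
    exact (add_sub_cancel _ _).symm
  rw [hν]
  exact Measure.le_add_right le_rfl

/-- Sequential compactness of the measures of mass at most one in the vague topology. -/
theorem exists_subseq_tendsto_integral (ρ : ℕ → Measure Y) [∀ n, IsFiniteMeasure (ρ n)]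
    (hρ : ∀ n, ρ n Set.univ ≤ 1) :
    ∃ μ : Measure Y, μ Set.univ ≤ 1 ∧ ∃ φ : ℕ → ℕ, StrictMono φ ∧
      ∀ f : C_c(Y, ℝ), Tendsto (fun k => ∫ x, f x ∂(ρ (φ k))) atTop (𝓝 (∫ x, f x ∂μ)) := by
  obtain ⟨u, hu⟩ := CompactlySupportedContinuousMap.exists_seq_dense (Y := Y)
  have hbd : ∀ f : C_c(Y, ℝ), ∃ C : ℝ, ∀ n, ∫ x, f x ∂(ρ n) ∈ Set.Icc (-C) C := by
    intro f
    obtain ⟨C, hC⟩ := f.hasCompactSupport.exists_bound_of_continuous f.continuous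
    refine ⟨max C 0, fun n => abs_le.1 ?_⟩
    simpa using abs_integral_sub_le_of_abs_sub_le (hρ n) (f := f) (g := 0) (ε := max C 0)
      (fun x => by simpa using Or.inl (hC x)) (le_max_right _ _)
  choose C hC using fun n => hbd (u n)
  -- Sequential compactness of a countable product of intervals replaces the diagonal extraction:
  -- one subsequence works for every `u n`.
  obtain ⟨a, -, φ, hφ, ha⟩ := (isCompact_univ_pi fun n => isCompact_Icc (a := -C n)
    (b := C n)).tendsto_subseq (x := fun k n => ∫ x, u n x ∂(ρ k)) (fun k n _ => hC n k)
  have hcauchy : ∀ f : C_c(Y, ℝ), ∃ l, Tendsto (fun k => ∫ x, f x ∂(ρ (φ k))) atTop (𝓝 l) := by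
    intro f
    apply cauchySeq_tendsto_of_complete
    rw [Metric.cauchySeq_iff']
    intro ε hε
    obtain ⟨n, hn⟩ := hu f (ε / 4) (by positivity)
    have hk := (tendsto_pi_nhds.1 ha n).cauchySeq
    obtain ⟨N, hN⟩ := Metric.cauchySeq_iff'.1 hk (ε / 4) (by positivity)
    refine ⟨N, fun k hk => ?_⟩
    have h1 := abs_integral_sub_le_of_abs_sub_le (hρ (φ k)) (fun x => (hn x).le) (by positivity)
    have h2 := abs_integral_sub_le_of_abs_sub_le (hρ (φ N)) (fun x => (hn x).le) (by positivity)
    have h3 := hN k hk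
    simp only [Function.comp, Real.dist_eq] at h3 ⊢
    rw [abs_lt] at *
    rw [abs_le] at h1 h2
    constructor <;> linarith
  choose Λ₀ hΛ₀ using hcauchy
  let Λ : C_c(Y, ℝ) →ₚ[ℝ] ℝ := PositiveLinearMap.mk₀
    { toFun := Λ₀
      map_add' := fun f g => by
        refine tendsto_nhds_unique (hΛ₀ (f + g)) (((hΛ₀ f).add (hΛ₀ g)).congr fun k => ?_)
        exact (integral_add f.integrable g.integrable).symm
      map_smul' := fun c f => by
        refine tendsto_nhds_unique (hΛ₀ (c • f)) (((hΛ₀ f).const_mul c).congr fun k => ?_)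
        exact (integral_const_mul c _).symm }
    (fun f hf => ge_of_tendsto' (hΛ₀ f) fun k => integral_nonneg hf)
  have hlim : ∀ f : C_c(Y, ℝ), Tendsto (fun k => ∫ x, f x ∂(ρ (φ k))) atTop
      (𝓝 (∫ x, f x ∂(RealRMK.rieszMeasure Λ))) := by
    intro f
    rw [RealRMK.integral_rieszMeasure]
    exact hΛ₀ f
  refine ⟨RealRMK.rieszMeasure Λ, ?_, φ, hφ, hlim⟩
  rw [← ENNReal.ofReal_one]
  refine measure_univ_le_of_integral_le fun f hf => le_of_tendsto' (hlim f) fun k => ?_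
  have h := abs_integral_sub_le_of_abs_sub_le (hρ (φ k)) (f := f) (g := 0) (ε := 1)
    (fun x => by simpa [abs_of_nonneg (hf x).1] using (hf x).2) zero_le_one
  simpa using (abs_le.1 h).2

end VagueTopology

/-! ### Topology of `X`, the Mautner phenomenon and ergodicity of the flow -/

namespace LatticeSpace

theorem isClosed_Gamma : IsClosed (Gamma : Set SL(2, ℝ)) := by
  have h : IsClosedEmbedding (Int.castRingHom ℝ) := Int.isClosedEmbedding_coe_real
  exact (h.specialLinearGroup_map (n := Fin 2)).isClosed_range

instance : SecondCountableTopology SL(2, ℝ) :=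
  have : SecondCountableTopology (Matrix (Fin 2) (Fin 2) ℝ) :=
    inferInstanceAs (SecondCountableTopology (Fin 2 → Fin 2 → ℝ))
  Matrix.SpecialLinearGroup.isClosedEmbedding_val.isEmbedding.secondCountableTopology

instance : LocallyCompactSpace SL(2, ℝ) :=
  have : LocallyCompactSpace (Matrix (Fin 2) (Fin 2) ℝ) :=
    inferInstanceAs (LocallyCompactSpace (Fin 2 → Fin 2 → ℝ))
  Matrix.SpecialLinearGroup.isClosedEmbedding_val.locallyCompactSpace

instance : LocallyCompactSpace X := inferInstanceAs (LocallyCompactSpace (SL(2, ℝ) ⧸ Gamma))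

instance : SecondCountableTopology X :=
  inferInstanceAs (SecondCountableTopology (SL(2, ℝ) ⧸ Gamma))

instance : T2Space X := by
  refine (t2Space_iff_of_isOpenQuotientMap (QuotientGroup.isOpenQuotientMap_mk
    (N := Gamma))).2 ?_
  simp only [QuotientGroup.eq]
  exact isClosed_Gamma.preimage (f := fun q : SL(2, ℝ) × SL(2, ℝ) => q.1⁻¹ * q.2) (by fun_prop)

instance : IsProbabilityMeasure haarX := isHaarProbability_haarX.1

theorem measurePreserving_smul_haarX (g : SL(2, ℝ)) :
    MeasurePreserving (fun x : X => g • x) haarX haarX :=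
  ⟨measurable_smul_X g, isHaarProbability_haarX.2 g⟩

theorem integrable_comp_smul {f : X → ℝ} (hf : Integrable f haarX) (g : SL(2, ℝ)) :
    Integrable (fun x => f (g • x)) haarX :=
  (measurePreserving_smul_haarX g).integrable_comp_of_integrable hf

/-- The `L¹` distance of `f` to its translate by `g`. -/
noncomputable def translationDist (f : X → ℝ) (g : SL(2, ℝ)) : ℝ :=
  ∫ x, |f (g • x) - f x| ∂haarX

/-- For a continuous compactly supported function this is dominated convergence. In general,
approximate in `L¹`: by invariance of `haarX` the approximation error is unchanged by translation,
so it only enters twice. -/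
theorem tendsto_translationDist {f : X → ℝ} (hf : Integrable f haarX) :
    Tendsto (translationDist f) (𝓝 1) (𝓝 0) := by
  rw [Metric.tendsto_nhds]
  intro ε hε
  obtain ⟨φ, hφs, hφ, hφc, hφi⟩ := hf.exists_hasCompactSupport_integral_sub_le
    (ε := ε / 3) (by positivity)
  obtain ⟨C, hC⟩ := hφs.exists_bound_of_continuous hφc
  have hcont : Tendsto (translationDist φ) (𝓝 1) (𝓝 0) := by
    have h : Tendsto (translationDist φ) (𝓝 1) (𝓝 (∫ _ : X, (0 : ℝ) ∂haarX)) := by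
      refine tendsto_integral_filter_of_dominated_convergence (fun _ => C + C)
        (Eventually.of_forall fun g => ?_) (Eventually.of_forall fun g =>
          Eventually.of_forall fun x => ?_) (integrable_const _) (Eventually.of_forall fun x => ?_)
      · exact ((hφc.comp (continuous_const_smul g)).sub hφc).abs.aestronglyMeasurable
      · rw [Real.norm_eq_abs, abs_abs]
        exact (abs_sub _ _).trans (add_le_add (hC _) (hC _))
      · have : Continuous fun g : SL(2, ℝ) => |φ (g • x) - φ x| :=
          ((hφc.comp (continuous_id.smul continuous_const)).sub continuous_const).abs
        simpa using this.tendsto 1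
    simpa using h
  filter_upwards [Metric.tendsto_nhds.1 hcont (ε / 3) (by positivity)] with g hg
  have h0 : ∀ ψ : X → ℝ, 0 ≤ translationDist ψ g := fun ψ =>
    integral_nonneg fun x => abs_nonneg _
  rw [Real.dist_0_eq_abs, abs_of_nonneg (h0 _)] at hg ⊢
  have hi := (hf.sub hφi).abs
  have hig := (integrable_comp_smul (hf.sub hφi) g).abs
  have hip := ((integrable_comp_smul hφi g).sub hφi).abs
  have he : ∫ x, |(f - φ) (g • x)| ∂haarX = ∫ x, |(f - φ) x| ∂haarX :=
    (measurePreserving_smul_haarX g).integral_comp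
      (Homeomorph.smul g).measurableEmbedding (fun x => |(f - φ) x|)
  calc translationDist f g
      ≤ ∫ x, (|(f - φ) (g • x)| + |φ (g • x) - φ x| + |(f - φ) x|) ∂haarX := by
        refine integral_mono ((integrable_comp_smul hf g).sub hf).abs
          ((hig.add hip).add hi) fun x => ?_
        simp only [Pi.sub_apply]
        rw [abs_sub_comm (f x) (φ x)]
        calc |f (g • x) - f x|
            = |(f (g • x) - φ (g • x)) + (φ (g • x) - φ x) + (φ x - f x)| := by congr 1; ring
          _ ≤ _ := abs_add_three _ _ _
    _ = ∫ x, |(f - φ) x| ∂haarX + translationDist φ g + ∫ x, |(f - φ) x| ∂haarX := by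
        refine (integral_add (hig.add hip) hi).trans (congrArg (· + _) ?_)
        exact (integral_add hig hip).trans (congrArg (· + _) he)
    _ < ε := by
        have : ∫ x, |(f - φ) x| ∂haarX ≤ ε / 3 := hφ
        linarith

theorem comp_smul_ae_eq {f f' : X → ℝ} (h : f =ᵐ[haarX] f') (g : SL(2, ℝ)) :
    (fun x => f (g • x)) =ᵐ[haarX] fun x => f' (g • x) :=
  (measurePreserving_smul_haarX g).quasiMeasurePreserving.ae_eq h

/-- Substitute `a • x` for `x`, then use the invariance of `f` under `a` at `x` and at `g • x`. -/
theorem translationDist_conj {f : X → ℝ} {a : SL(2, ℝ)}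
    (ha : (fun x => f (a • x)) =ᵐ[haarX] f) (g : SL(2, ℝ)) :
    translationDist f (a * g * a⁻¹) = translationDist f g := by
  unfold translationDist
  rw [← (measurePreserving_smul_haarX a).integral_comp (Homeomorph.smul a).measurableEmbedding]
  refine integral_congr_ae ?_
  filter_upwards [ha, comp_smul_ae_eq ha g] with x h1 h2
  simp only [smul_smul, inv_mul_cancel_right] at h2 ⊢
  rw [h1, h2]

/-- **Mautner's phenomenon**. -/
theorem comp_smul_ae_eq_of_tendsto_conj {f : X → ℝ} (hf : Integrable f haarX)
    {a : ℕ → SL(2, ℝ)} (ha : ∀ n, (fun x => f (a n • x)) =ᵐ[haarX] f) {g : SL(2, ℝ)}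
    (hg : Tendsto (fun n => a n * g * (a n)⁻¹) atTop (𝓝 1)) :
    (fun x => f (g • x)) =ᵐ[haarX] f := by
  have h : translationDist f g = 0 := by
    have := (tendsto_translationDist hf).comp hg
    simp only [Function.comp_def, translationDist_conj (ha _)] at this
    exact tendsto_nhds_unique tendsto_const_nhds this
  have h2 := (integral_eq_zero_iff_of_nonneg (fun x => abs_nonneg _)
    ((integrable_comp_smul hf g).sub hf).abs).1 h
  filter_upwards [h2] with x hx
  exact sub_eq_zero.1 (abs_eq_zero.1 hx)

/-- Upper unipotent matrices. -/
def upper (s : ℝ) : SL(2, ℝ) := ⟨!![1, s; 0, 1], by simp⟩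

/-- Lower unipotent matrices. -/
def lower (s : ℝ) : SL(2, ℝ) := ⟨!![1, 0; s, 1], by simp⟩

theorem coe_upper (s : ℝ) : (upper s : Matrix (Fin 2) (Fin 2) ℝ) = !![1, s; 0, 1] := rfl

theorem coe_lower (s : ℝ) : (lower s : Matrix (Fin 2) (Fin 2) ℝ) = !![1, 0; s, 1] := rfl

theorem coe_flow (t : ℝ) : (flow t : Matrix (Fin 2) (Fin 2) ℝ) =
    !![Real.exp (t / 2), 0; 0, Real.exp (-(t / 2))] := rfl

theorem continuous_upper : Continuous upper :=
  Continuous.subtype_mk (continuous_matrix fun i j => by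
    fin_cases i <;> fin_cases j <;> simp <;> fun_prop) _

theorem continuous_lower : Continuous lower :=
  Continuous.subtype_mk (continuous_matrix fun i j => by
    fin_cases i <;> fin_cases j <;> simp <;> fun_prop) _

theorem upper_zero : upper 0 = 1 := by
  ext i j; fin_cases i <;> fin_cases j <;> simp [upper]

theorem lower_zero : lower 0 = 1 := by
  ext i j; fin_cases i <;> fin_cases j <;> simp [lower]

theorem flow_mul_upper (t s : ℝ) :
    flow t * upper s * (flow t)⁻¹ = upper (Real.exp t * s) := by
  have h : Real.exp t = Real.exp (t / 2) * Real.exp (t / 2) := by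
    rw [← Real.exp_add, add_halves]
  rw [mul_inv_eq_iff_eq_mul, h]
  ext i j
  fin_cases i <;> fin_cases j <;> simp [coe_upper, coe_flow, Matrix.mul_apply, Fin.sum_univ_two]
  rw [Real.exp_neg]
  field_simp

theorem flow_mul_lower (t s : ℝ) :
    flow t * lower s * (flow t)⁻¹ = lower (Real.exp (-t) * s) := by
  have h : Real.exp (-t) = Real.exp (-(t / 2)) * Real.exp (-(t / 2)) := by
    rw [← Real.exp_add]; congr 1; ring
  rw [mul_inv_eq_iff_eq_mul, h]
  ext i j
  fin_cases i <;> fin_cases j <;> simp [coe_lower, coe_flow, Matrix.mul_apply, Fin.sum_univ_two]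
  rw [Real.exp_neg]
  field_simp

/-- Unipotents generate the group: three factors suffice off the upper triangular matrices. The
upper right entry is forced by the determinant. -/
theorem eq_upper_mul_lower_mul_upper {g : SL(2, ℝ)} (hc : g 1 0 ≠ 0) :
    g = upper ((g 0 0 - 1) / g 1 0) * lower (g 1 0) * upper ((g 1 1 - 1) / g 1 0) := by
  have hd : g 0 0 * g 1 1 - g 0 1 * g 1 0 = 1 := by
    have := g.2
    rwa [Matrix.det_fin_two] at this
  ext i j
  fin_cases i <;> fin_cases j <;> simp [coe_lower, coe_upper, Matrix.mul_apply, Fin.sum_univ_two]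
  all_goals field_simp
  all_goals linarith

theorem comp_smul_mul_ae_eq {f : X → ℝ} {g h : SL(2, ℝ)}
    (hg : (fun x => f (g • x)) =ᵐ[haarX] f) (hh : (fun x => f (h • x)) =ᵐ[haarX] f) :
    (fun x => f ((g * h) • x)) =ᵐ[haarX] f := by
  simp only [mul_smul]
  exact (comp_smul_ae_eq hg h).trans hh

/-- Conjugation by `flow t` scales `upper` by `exp t` and `lower` by `exp (-t)`, so negative times
contract the former, positive times the latter, and Mautner applies to both. -/
theorem comp_smul_ae_eq_of_flow {f : X → ℝ} (hf : Integrable f haarX)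
    (hfl : ∀ t, (fun x => f (flow t • x)) =ᵐ[haarX] f) (g : SL(2, ℝ)) :
    (fun x => f (g • x)) =ᵐ[haarX] f := by
  have hexp : Tendsto (fun n : ℕ => Real.exp (-(n : ℝ))) atTop (𝓝 0) :=
    Real.tendsto_exp_neg_atTop_nhds_zero.comp tendsto_natCast_atTop_atTop
  have hu : ∀ s, (fun x => f (upper s • x)) =ᵐ[haarX] f := by
    intro s
    refine comp_smul_ae_eq_of_tendsto_conj hf (fun n : ℕ => hfl (-n)) ?_
    simp only [flow_mul_upper]
    have h := (continuous_upper.tendsto _).comp (hexp.mul_const s)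
    rwa [zero_mul, upper_zero] at h
  have hl : ∀ s, (fun x => f (lower s • x)) =ᵐ[haarX] f := by
    intro s
    refine comp_smul_ae_eq_of_tendsto_conj hf (fun n : ℕ => hfl n) ?_
    simp only [flow_mul_lower]
    have h := (continuous_lower.tendsto _).comp (hexp.mul_const s)
    rwa [zero_mul, lower_zero] at h
  have hc : ∀ g : SL(2, ℝ), g 1 0 ≠ 0 → (fun x => f (g • x)) =ᵐ[haarX] f := by
    intro g hg
    rw [eq_upper_mul_lower_mul_upper hg]
    exact comp_smul_mul_ae_eq (comp_smul_mul_ae_eq (hu _) (hl _)) (hu _)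
  by_cases hg : g 1 0 = 0
  -- An upper triangular `g` is moved off the exceptional set by `lower 1`, since its upper left
  -- entry is nonzero.
  · have h1 : g = lower (-1) * (lower 1 * g) := by
      rw [← mul_assoc]
      have : lower (-1) * lower 1 = 1 := by
        ext i j; fin_cases i <;> fin_cases j <;> simp [coe_lower]
      rw [this, one_mul]
    rw [h1]
    refine comp_smul_mul_ae_eq (hl _) (hc _ ?_)
    have h2 : (lower 1 * g) 1 0 = g 0 0 + g 1 0 := by
      simp [coe_lower, Matrix.mul_apply, Fin.sum_univ_two]
    rw [h2, hg, add_zero]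
    intro h0
    have := g.2
    rw [Matrix.det_fin_two, hg, h0] at this
    simp at this
  · exact hc g hg

theorem continuousOn_toG : ContinuousOn toG {x | 0 < cdet x} := by
  have hi : IsInducing fun g : SL(2, ℝ) => (g : Matrix (Fin 2) (Fin 2) ℝ) :=
    Matrix.SpecialLinearGroup.isClosedEmbedding_val.isInducing
  refine hi.continuousOn_iff.2 ?_
  have hm : Continuous fun x : Cols =>
      (!![x.1.1, x.2.1; x.1.2, x.2.2] : Matrix (Fin 2) (Fin 2) ℝ) := by
    refine continuous_matrix fun i j => ?_
    fin_cases i <;> fin_cases j <;> simp <;> fun_prop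
  have hs : ContinuousOn (fun x => (√(cdet x))⁻¹) {x | 0 < cdet x} :=
    (Real.continuous_sqrt.comp continuous_cdet).continuousOn.inv₀
      fun x hx => (Real.sqrt_pos.2 hx).ne'
  exact (hs.smul hm.continuousOn).congr fun x hx => coe_toG hx

/-- Joint measurability is what permits Fubini in `ae_eq_const_of_comp_smul_ae_eq`, where Lebesgue
measure on `Cols` stands in for Haar measure on the group. -/
theorem measurable_toG_smul : Measurable fun p : Cols × X => toG p.1 • p.2 := by
  classical
  have ho : IsOpen {p : Cols × X | 0 < cdet p.1} :=
    isOpen_lt continuous_const (continuous_cdet.comp continuous_fst)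
  have h1 : ContinuousOn (fun p : Cols × X => toG p.1 • p.2) {p : Cols × X | 0 < cdet p.1} :=
    (continuousOn_toG.comp continuousOn_fst fun p hp => hp).smul continuousOn_snd
  have h := h1.measurable_piecewise (g := Prod.snd) continuousOn_snd ho.measurableSet
  convert h using 1
  funext p
  by_cases hp : 0 < cdet p.1
  · simp [hp]
  · rw [Set.piecewise_eq_of_notMem _ _ _ (show p ∉ {p : Cols × X | 0 < cdet p.1} from hp),
      toG_of_not hp, one_smul]

/-- Right multiplication by a matrix in `SL₂(ℝ)`. -/
def rmulReal (g : SL(2, ℝ)) : Cols →ₗ[ℝ] Cols where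
  toFun x := (g 0 0 • x.1 + g 1 0 • x.2, g 0 1 • x.1 + g 1 1 • x.2)
  map_add' x y := by ext <;> simp <;> ring
  map_smul' c x := by ext <;> simp <;> ring

theorem rmulReal_apply (g : SL(2, ℝ)) (x : Cols) :
    rmulReal g x = (g 0 0 • x.1 + g 1 0 • x.2, g 0 1 • x.1 + g 1 1 • x.2) := rfl

theorem quasiMeasurePreserving_rmulReal (g : SL(2, ℝ)) :
    Measure.QuasiMeasurePreserving (rmulReal g) (volume : Measure Cols) volume := by
  have h : rmulReal g⁻¹ ∘ₗ rmulReal g = LinearMap.id := by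
    have hd : g 0 0 * g 1 1 - g 0 1 * g 1 0 = 1 := by
      have := g.2
      rwa [Matrix.det_fin_two] at this
    refine LinearMap.ext fun x => ?_
    rw [LinearMap.comp_apply, rmulReal_apply, rmulReal_apply]
    simp only [Matrix.SpecialLinearGroup.SL2_inv_expl]
    ext <;> simp
    · linear_combination x.1.1 * hd
    · linear_combination x.1.2 * hd
    · linear_combination x.2.1 * hd
    · linear_combination x.2.2 * hd
  have hdet : LinearMap.det (rmulReal g) ≠ 0 := by
    intro h0
    have := congrArg LinearMap.det h
    rw [LinearMap.det_comp, h0] at this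
    simp at this
  have : (volume : Measure Cols).IsAddHaarMeasure := by
    have : (volume : Measure (ℝ × ℝ)).IsAddHaarMeasure := inferInstance
    exact inferInstanceAs (volume.prod volume).IsAddHaarMeasure
  refine ⟨(rmulReal g).continuous_of_finiteDimensional.measurable, ?_⟩
  rw [Measure.map_linearMap_addHaar_eq_smul_addHaar _ hdet]
  exact Measure.smul_absolutelyContinuous

theorem cdet_rmulReal (g : SL(2, ℝ)) (x : Cols) : cdet (rmulReal g x) = cdet x := by
  have h : g 0 0 * g 1 1 - g 0 1 * g 1 0 = 1 := by
    have := g.2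
    rwa [Matrix.det_fin_two] at this
  simp only [cdet, rmulReal_apply, Prod.fst_add, Prod.snd_add, Prod.smul_fst, Prod.smul_snd,
    smul_eq_mul]
  linear_combination (x.1.1 * x.2.2 - x.2.1 * x.1.2) * h

theorem toG_rmulReal (g : SL(2, ℝ)) {x : Cols} (h : 0 < cdet x) :
    toG (rmulReal g x) = toG x * g := by
  apply Subtype.ext
  rw [coe_toG (by rwa [cdet_rmulReal]), Matrix.SpecialLinearGroup.coe_mul, coe_toG h,
    cdet_rmulReal, Matrix.smul_mul]
  congr 1
  ext i j
  fin_cases i <;> fin_cases j <;>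
    simp [rmulReal_apply, Matrix.mul_apply, Fin.sum_univ_two] <;> ring

/-- A function invariant under each translation, up to null sets, is constant. -/
theorem ae_eq_const_of_comp_smul_ae_eq {f : X → ℝ} (hf : Measurable f)
    (h : ∀ g : SL(2, ℝ), (fun x => f (g • x)) =ᵐ[haarX] f) :
    ∃ c, ∀ᵐ x ∂haarX, f x = c := by
  have hS : MeasurableSet {p : Cols × X | f (toG p.1 • p.2) = f p.2} :=
    measurableSet_eq_fun (hf.comp measurable_toG_smul) (hf.comp measurable_snd)
  -- Exchange the quantifiers: from "for every `A`, almost every `x`" to a single base point `x₀`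
  -- that works for almost every `A`.
  obtain ⟨x₀, hx₀⟩ := ((Measure.ae_ae_comm (μ := (volume : Measure Cols)) (ν := haarX)
    (p := fun A x => f (toG A • x) = f x) hS).1 (Eventually.of_forall fun A => h (toG A))).exists
  obtain ⟨g₀, rfl⟩ := QuotientGroup.mk_surjective (s := Gamma) x₀
  -- Replacing `A` by `A g₀⁻¹` preserves null sets and cancels the base point: the translate of `x₀`
  -- becomes `toX A`, whose law under `weight` is `preHaar`.
  have hA := (quasiMeasurePreserving_rmulReal g₀⁻¹).ae hx₀
  refine ⟨f (QuotientGroup.mk (s := Gamma) g₀), Measure.ae_smul_measure ?_ _⟩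
  rw [preHaar, ae_map_iff measurable_toX.aemeasurable (measurableSet_eq_fun hf measurable_const),
    ae_withDensity_iff measurable_weight]
  filter_upwards [hA] with A hA hw
  have hD := (weight_ne_zero hw).1
  rw [← hA, toG_rmulReal _ hD]
  congr 1
  change _ = QuotientGroup.mk (s := Gamma) (toG A * g₀⁻¹ * g₀)
  rw [inv_mul_cancel_right]
  rfl

/-- Ergodicity of the flow, for absolutely continuous invariant measures. -/
theorem FlowInvariant.eq_smul_haarX {μ : Measure X} [IsFiniteMeasure μ] (hμ : FlowInvariant μ)
    (hac : μ ≪ haarX) : μ = μ Set.univ • haarX := by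
  set h := μ.rnDeriv haarX with hh
  have hm : Measurable h := Measure.measurable_rnDeriv _ _
  have hd : haarX.withDensity h = μ := Measure.withDensity_rnDeriv_eq _ _ hac
  have hflow : ∀ t, (fun x => h (flow t • x)) =ᵐ[haarX] h := by
    intro t
    have hmp := measurePreserving_smul_haarX (flow t)
    -- The translated density has the same integral over `B` as the original: it equals the `μ`-mass
    -- of the translate of `B` by `flow t`, which is that of `B` by invariance.
    refine (withDensity_eq_iff (hm.comp hmp.measurable).aemeasurable hm.aemeasurable ?_).1 ?_
    · rw [Function.comp_def, hmp.lintegral_comp hm]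
      exact (Measure.lintegral_rnDeriv_lt_top _ _).ne
    · ext B hB
      have hB' := measurable_smul_X (flow t)⁻¹ hB
      have hBe : B = (fun x => flow t • x) ⁻¹' ((fun x => (flow t)⁻¹ • x) ⁻¹' B) := by
        ext x; simp
      rw [hd, withDensity_apply _ hB]
      conv_lhs => rw [hBe]
      rw [Function.comp_def, hmp.setLIntegral_comp_preimage hB' hm, ← withDensity_apply _ hB', hd]
      conv_rhs => rw [hBe, ← Measure.map_apply hmp.measurable hB', hμ t]
  obtain ⟨c, hc⟩ := ae_eq_const_of_comp_smul_ae_eq (f := fun x => (h x).toReal) hm.ennreal_toReal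
    (comp_smul_ae_eq_of_flow Measure.integrable_toReal_rnDeriv fun t => by
      filter_upwards [hflow t] with x hx
      exact congrArg _ hx)
  have hconst : μ = ENNReal.ofReal c • haarX := by
    rw [← hd, ← withDensity_const]
    refine withDensity_congr_ae ?_
    filter_upwards [hc, Measure.rnDeriv_lt_top μ haarX] with x h1 h2
    rw [← h1, ENNReal.ofReal_toReal h2.ne]
  rw [hconst]
  simp

end LatticeSpace

/-! ### Averages over subsets of positive proportion -/

theorem Finset.inv_card_mul_sum_le {ι : Type*} {B S : Finset ι} (hBS : B ⊆ S) (hB : B.Nonempty)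
    {δ : ℝ} (hδ : 0 < δ) (h : δ ≤ (B.card : ℝ) / S.card) {a : ι → ℝ} (ha : ∀ i, 0 ≤ a i) :
    (B.card : ℝ)⁻¹ * ∑ i ∈ B, a i ≤ δ⁻¹ * ((S.card : ℝ)⁻¹ * ∑ i ∈ S, a i) := by
  have hBc : (0 : ℝ) < B.card := Nat.cast_pos.2 hB.card_pos
  have hSc : (0 : ℝ) < S.card := Nat.cast_pos.2 (hB.mono hBS).card_pos
  have h1 : (B.card : ℝ)⁻¹ ≤ δ⁻¹ * (S.card : ℝ)⁻¹ := by
    rw [← mul_inv]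
    exact inv_anti₀ (by positivity) ((le_div_iff₀ hSc).1 h)
  rw [← mul_assoc]
  exact mul_le_mul h1 (Finset.sum_le_sum_of_subset_of_nonneg hBS fun i _ _ => ha i)
    (Finset.sum_nonneg fun i _ => ha i) (by positivity)

namespace LatticeSpace

theorem avg_univ {Ω : Finset (ProbabilityMeasure X)} (h : Ω.Nonempty) :
    avg Ω Set.univ = 1 := by
  simp only [avg, Measure.smul_apply, Measure.finsetSum_apply, measure_univ, Finset.sum_const,
    nsmul_eq_mul, mul_one, smul_eq_mul]
  exact ENNReal.inv_mul_cancel (by simpa using h.ne_empty) (ENNReal.natCast_ne_top _)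

theorem isProbabilityMeasure_avg {Ω : Finset (ProbabilityMeasure X)} (h : Ω.Nonempty) :
    IsProbabilityMeasure (avg Ω) := ⟨avg_univ h⟩

theorem integral_avg (Ω : Finset (ProbabilityMeasure X)) (f : C_c(X, ℝ)) :
    ∫ x, f x ∂(avg Ω) = (Ω.card : ℝ)⁻¹ * ∑ ν ∈ Ω, ∫ x, f x ∂(ν : Measure X) := by
  rw [avg, integral_smul_measure, integral_finsetSum_measure fun ν _ => f.integrable]
  simp

/-- `haarX` is an extreme point among the flow invariant measures, in the following sense: limits of
averages over subsets of positive proportion inherit the limit `haarX`. -/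
theorem eq_haarX_of_tendsto_avg {Ω B : ℕ → Finset (ProbabilityMeasure X)} (hB : ∀ k, B k ⊆ Ω k)
    (hne : ∀ k, (B k).Nonempty) {δ : ℝ} (hδ : 0 < δ)
    (hcard : ∀ k, δ ≤ ((B k).card : ℝ) / (Ω k).card)
    (hΩ : WeakStarTendsto (fun k => avg (Ω k)) haarX) {μ : Measure X} (hμ1 : μ Set.univ ≤ 1)
    (hμ : WeakStarTendsto (fun k => avg (B k)) μ) (hinv : FlowInvariant μ) : μ = haarX := by
  have : IsFiniteMeasure μ := ⟨hμ1.trans_lt ENNReal.one_lt_top⟩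
  -- Domination passes to the limit and supplies the absolute continuity that ergodicity requires.
  have hle : μ ≤ ENNReal.ofReal δ⁻¹ • haarX := by
    have := haarX.smul_finite (c := ENNReal.ofReal δ⁻¹) ENNReal.ofReal_ne_top
    refine measure_le_of_integral_le fun f hf => ?_
    rw [integral_smul_measure, ENNReal.toReal_ofReal (by positivity), smul_eq_mul]
    refine le_of_tendsto_of_tendsto' (hμ f) ((hΩ f).const_mul _) fun k => ?_
    rw [integral_avg, integral_avg]
    exact Finset.inv_card_mul_sum_le (hB k) (hne k) hδ (hcard k) fun ν => integral_nonneg hf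
  have hmass : 1 ≤ μ.real Set.univ := by
    refine le_of_forall_pos_sub_le fun η hη => ?_
    -- The tolerance is `δ * η` because passing to a subset multiplies mass outside `K` by at most
    -- `δ⁻¹`.
    obtain ⟨K, -, hK, hKη⟩ := MeasurableSet.univ.exists_isCompact_lt_add (μ := haarX)
      (measure_ne_top _ _) (ε := ENNReal.ofReal (δ * η)) (by simpa using mul_pos hδ hη)
    obtain ⟨f, hf1, hf⟩ := exists_compactlySupported_one_on hK
    have hKf := measureReal_le_integral_of_one_on (μ := haarX) hK hf1 fun x => (hf x).1
    have hKη' : 1 < haarX.real K + δ * η := by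
      rw [measure_univ, ← ENNReal.ofReal_toReal (measure_ne_top haarX K),
        ← ENNReal.ofReal_add ENNReal.toReal_nonneg (by positivity), ← ENNReal.ofReal_one] at hKη
      exact (ENNReal.ofReal_lt_ofReal_iff (by
        have := measureReal_nonneg (μ := haarX) (s := K)
        have := mul_pos hδ hη
        change 0 < haarX.real K + _
        linarith)).1 hKη
    have hfμ : ∫ x, f x ∂μ ≤ μ.real Set.univ := by
      have := integral_mono f.integrable (integrable_const (μ := μ) (1 : ℝ)) fun x => (hf x).2
      simpa using this
    -- The comparison of averages is applied to the nonnegative numbers `1 - ∫ f dν`. The function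
    -- `1 - f` need not have compact support, so the limit is taken through `f`.
    have hlim : 1 - ∫ x, f x ∂μ ≤ δ⁻¹ * (1 - ∫ x, f x ∂haarX) := by
      refine le_of_tendsto_of_tendsto' ((hμ f).const_sub 1) (((hΩ f).const_sub 1).const_mul _)
        fun k => ?_
      have h := Finset.inv_card_mul_sum_le (hB k) (hne k) hδ (hcard k)
        (a := fun ν => 1 - ∫ x, f x ∂(ν : Measure X)) fun ν => by
          have := integral_mono f.integrable (integrable_const (μ := (ν : Measure X)) (1 : ℝ))
            fun x => (hf x).2
          simpa using this
      have hBc : ((B k).card : ℝ) ≠ 0 := Nat.cast_ne_zero.2 (hne k).card_pos.ne'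
      have hSc : ((Ω k).card : ℝ) ≠ 0 := Nat.cast_ne_zero.2 ((hne k).mono (hB k)).card_pos.ne'
      simpa [Finset.sum_sub_distrib, mul_sub, hBc, hSc, integral_avg] using h
    have hfin : δ⁻¹ * (1 - ∫ x, f x ∂haarX) ≤ η := by
      rw [inv_mul_le_iff₀ hδ]
      linarith
    linarith
  have h1 : μ Set.univ = 1 := by
    refine le_antisymm hμ1 ?_
    rw [← ENNReal.ofReal_one, ← ENNReal.ofReal_toReal (measure_ne_top μ Set.univ)]
    exact ENNReal.ofReal_le_ofReal hmass
  have h := hinv.eq_smul_haarX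
    ((Measure.absolutelyContinuous_of_le hle).trans Measure.smul_absolutelyContinuous)
  rwa [h1, one_smul] at h

-- The one-sided inequality survives averaging: if the proportion did not tend to zero, the averages
-- over the bad measures would have `haarX` as a limit point while keeping the excess `ε`.
open Classical in
theorem tendsto_card_filter_le_integral_sub {Ω : ℕ → Finset (ProbabilityMeasure X)}
    (hne : ∀ q, (Ω q).Nonempty) (hinv : UniformlyAlmostInvariant Ω)
    (havg : WeakStarTendsto (fun q => avg (Ω q)) haarX) (f : C_c(X, ℝ)) {ε : ℝ} (hε : 0 < ε) :
    Tendsto (fun q => (((Ω q).filter fun ν : ProbabilityMeasure X =>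
      ε ≤ ∫ x, f x ∂(ν : Measure X) - ∫ x, f x ∂haarX).card : ℝ) / (Ω q).card) atTop (𝓝 0) := by
  set B : ℕ → Finset (ProbabilityMeasure X) := fun q => (Ω q).filter fun ν =>
    ε ≤ ∫ x, f x ∂(ν : Measure X) - ∫ x, f x ∂haarX with hBdef
  by_contra hcon
  rw [Metric.tendsto_atTop'] at hcon
  push Not at hcon
  obtain ⟨δ, hδ, hfreq⟩ := hcon
  obtain ⟨φ, hφ, hφδ⟩ := extraction_of_frequently_atTop (frequently_atTop'.2 fun a => hfreq a)
  have hcard : ∀ k, δ ≤ ((B (φ k)).card : ℝ) / (Ω (φ k)).card := fun k => by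
    have := hφδ k
    rwa [Real.dist_0_eq_abs, abs_of_nonneg (by positivity)] at this
  have hBne : ∀ k, (B (φ k)).Nonempty := fun k => by
    rw [Finset.nonempty_iff_ne_empty]
    intro h0
    have := hcard k
    rw [h0] at this
    simp at this
    linarith
  -- Almost invariance speaks of non-empty subsets at every index. Off the subsequence `φ` the
  -- choice is immaterial, so `Ω q` fills the gaps.
  let Ω' : ℕ → Finset (ProbabilityMeasure X) := fun q => if (B q).Nonempty then B q else Ω q
  have hΩ'B : ∀ k, Ω' (φ k) = B (φ k) := fun k => if_pos (hBne k)
  have hprob := fun k => isProbabilityMeasure_avg (hBne k)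
  obtain ⟨μ, hμ1, ψ, hψ, hμ⟩ := exists_subseq_tendsto_integral (fun k => avg (B (φ k)))
    fun k => (avg_univ (hBne k)).le
  have hflow : FlowInvariant μ := by
    refine hinv Ω' (fun q => ?_) (fun q => ?_) μ
      ⟨⟨hμ1.trans_lt ENNReal.one_lt_top⟩, φ ∘ ψ, hφ.comp hψ, ?_⟩
    · by_cases h : (B q).Nonempty
      · simpa only [Ω', if_pos h] using Finset.filter_subset _ _
      · simp only [Ω', if_neg h, subset_rfl]
    · by_cases h : (B q).Nonempty
      · simpa only [Ω', if_pos h] using h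
      · simpa only [Ω', if_neg h] using hne q
    · simpa only [WeakStarTendsto, Function.comp, hΩ'B] using hμ
  have hμX : μ = haarX := eq_haarX_of_tendsto_avg (Ω := fun k => Ω (φ (ψ k)))
    (B := fun k => B (φ (ψ k))) (fun k => Finset.filter_subset _ _) (fun k => hBne _) hδ
    (fun k => hcard _) (fun g => (havg g).comp (hφ.comp hψ).tendsto_atTop) hμ1 hμ hflow
  have hge : ∫ x, f x ∂haarX + ε ≤ ∫ x, f x ∂μ := by
    refine ge_of_tendsto' (hμ f) fun k => ?_
    rw [integral_avg, le_inv_mul_iff₀ (Nat.cast_pos.2 (hBne _).card_pos), ← nsmul_eq_mul]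
    refine Finset.card_nsmul_le_sum _ _ _ fun ν hν => ?_
    have := (Finset.mem_filter.1 hν).2
    linarith
  rw [hμX] at hge
  linarith

-- A union bound over finitely many test functions, with `-u i` covering deviations from below.
open Classical in
theorem tendsto_card_filter_not_forall_abs_lt {Ω : ℕ → Finset (ProbabilityMeasure X)}
    (hne : ∀ q, (Ω q).Nonempty) (hinv : UniformlyAlmostInvariant Ω)
    (havg : WeakStarTendsto (fun q => avg (Ω q)) haarX) (u : ℕ → C_c(X, ℝ)) (n : ℕ) {ε : ℝ}
    (hε : 0 < ε) :
    Tendsto (fun q => (((Ω q).filter fun ν : ProbabilityMeasure X =>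
      ¬ ∀ i < n, |∫ x, u i x ∂(ν : Measure X) - ∫ x, u i x ∂haarX| < ε).card : ℝ) / (Ω q).card)
      atTop (𝓝 0) := by
  let B : C_c(X, ℝ) → ℕ → Finset (ProbabilityMeasure X) := fun f q => (Ω q).filter fun ν =>
    ε ≤ ∫ x, f x ∂(ν : Measure X) - ∫ x, f x ∂haarX
  have hlim : Tendsto (fun q => ∑ i ∈ Finset.range n, (((B (u i) q).card : ℝ) / (Ω q).card +
      ((B (-u i) q).card : ℝ) / (Ω q).card)) atTop (𝓝 0) := by
    have h := tendsto_finsetSum (Finset.range n) fun i _ =>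
      (tendsto_card_filter_le_integral_sub hne hinv havg (u i) hε).add
        (tendsto_card_filter_le_integral_sub hne hinv havg (-u i) hε)
    simp only [add_zero, Finset.sum_const_zero] at h
    exact h
  refine squeeze_zero (fun q => by positivity) (fun q => ?_) hlim
  simp only [← add_div, ← Finset.sum_div]
  gcongr
  have hsub : ((Ω q).filter fun ν : ProbabilityMeasure X =>
      ¬ ∀ i < n, |∫ x, u i x ∂(ν : Measure X) - ∫ x, u i x ∂haarX| < ε) ⊆
      (Finset.range n).biUnion fun i => B (u i) q ∪ B (-u i) q := by
    intro ν hν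
    obtain ⟨hν, h⟩ := Finset.mem_filter.1 hν
    push Not at h
    obtain ⟨i, hi, h⟩ := h
    simp only [B, Finset.mem_biUnion, Finset.mem_range, Finset.mem_union, Finset.mem_filter, hν,
      true_and, CompactlySupportedContinuousMap.neg_apply, integral_neg]
    refine ⟨i, hi, (le_abs.1 h).imp id fun h => ?_⟩
    linarith
  refine (Nat.cast_le.2 ((Finset.card_le_card hsub).trans (Finset.card_biUnion_le.trans
    (Finset.sum_le_sum fun i _ => Finset.card_union_le _ _)))).trans ?_
  push_cast
  rfl

end LatticeSpace

/-! ### Diagonal choice of the good subsets -/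

theorem mainTheorem7
    (Ω : ℕ → Finset (ProbabilityMeasure LatticeSpace.X))
    (hne : ∀ q, (Ω q).Nonempty)
    (hinv : LatticeSpace.UniformlyAlmostInvariant Ω)
    (havg : LatticeSpace.WeakStarTendsto (fun q => LatticeSpace.avg (Ω q)) LatticeSpace.haarX) :
    ∃ Ω' : ℕ → Finset (ProbabilityMeasure LatticeSpace.X),
      (∀ q, Ω' q ⊆ Ω q) ∧
      (∀ q, (Ω' q).Nonempty) ∧
      Tendsto (fun q => ((Ω' q).card : ℝ) / ((Ω q).card : ℝ)) atTop (𝓝 1) ∧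
      ∀ ν : ℕ → ProbabilityMeasure LatticeSpace.X, (∀ q, ν q ∈ Ω' q) →
        LatticeSpace.WeakStarTendsto (fun q => (ν q : Measure LatticeSpace.X))
          LatticeSpace.haarX := by
  classical
  obtain ⟨u, hu⟩ := CompactlySupportedContinuousMap.exists_seq_dense (Y := LatticeSpace.X)
  let good : ℕ → ProbabilityMeasure LatticeSpace.X → Prop := fun n ν => ∀ i < n,
    |∫ x, u i x ∂(ν : Measure LatticeSpace.X) - ∫ x, u i x ∂LatticeSpace.haarX| < 1 / ((n : ℝ) + 1)
  let r : ℕ → ℕ → ℝ := fun n q => (((Ω q).filter fun ν => ¬ good n ν).card : ℝ) / (Ω q).card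
  have hr : ∀ n, Tendsto (r n) atTop (𝓝 0) := fun n =>
    LatticeSpace.tendsto_card_filter_not_forall_abs_lt hne hinv havg u n (by positivity)
  -- The number of test functions controlled at stage `q` grows as slowly as needed for the bad
  -- proportion to stay below `1 / (n + 1)`. The value `n = 0` always qualifies, as `good 0` is
  -- vacuous; the cap `q` makes the maximum exist.
  let N : ℕ → ℕ := fun q => Nat.findGreatest (fun n => r n q ≤ 1 / ((n : ℝ) + 1)) q
  have hrN : ∀ q, r (N q) q ≤ 1 / ((N q : ℝ) + 1) := fun q =>
    Nat.findGreatest_spec (P := fun n => r n q ≤ 1 / ((n : ℝ) + 1)) (Nat.zero_le q)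
      (by simp [r, good])
  have hN : Tendsto N atTop atTop := by
    refine tendsto_atTop.2 fun n => ?_
    filter_upwards [eventually_ge_atTop n,
      (hr n).eventually (eventually_le_nhds (by positivity : (0 : ℝ) < 1 / ((n : ℝ) + 1)))]
      with q h1 h2 using Nat.le_findGreatest h1 h2
  have hN1 : Tendsto (fun q => 1 / ((N q : ℝ) + 1)) atTop (𝓝 0) :=
    tendsto_one_div_add_atTop_nhds_zero_nat.comp hN
  let G : ℕ → Finset (ProbabilityMeasure LatticeSpace.X) := fun q => (Ω q).filter (good (N q))
  have hc : ∀ q, (0 : ℝ) < (Ω q).card := fun q => Nat.cast_pos.2 (hne q).card_pos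
  have hG : ∀ q, ((G q).card : ℝ) / (Ω q).card = 1 - r (N q) q := by
    intro q
    have h := Finset.card_filter_add_card_filter_not (s := Ω q) (good (N q))
    rw [eq_sub_iff_add_eq, ← add_div, div_eq_one_iff_eq (hc q).ne']
    exact_mod_cast h
  have hGne : ∀ q, 1 ≤ N q → (G q).Nonempty := by
    intro q hq
    rw [Finset.nonempty_iff_ne_empty]
    intro h0
    have h1 := hG q
    have h2 : 1 / ((N q : ℝ) + 1) < 1 := by
      have : (1 : ℝ) ≤ N q := by exact_mod_cast hq
      rw [div_lt_one (by positivity)]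
      linarith
    rw [h0] at h1
    simp at h1
    linarith [hrN q]
  -- At `N q = 0` the bound on the bad proportion is only `1`, which does not force `G q` to be
  -- non-empty. This happens for finitely many `q`.
  let Ω' : ℕ → Finset (ProbabilityMeasure LatticeSpace.X) := fun q =>
    if 1 ≤ N q then G q else Ω q
  have hpos : ∀ᶠ q in atTop, Ω' q = G q := by
    filter_upwards [hN.eventually_ge_atTop 1] with q hq using if_pos hq
  refine ⟨Ω', fun q => ?_, fun q => ?_, ?_, fun ν hν f => ?_⟩
  · by_cases h : 1 ≤ N q
    · simpa only [Ω', if_pos h] using Finset.filter_subset _ _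
    · simp only [Ω', if_neg h, subset_rfl]
  · by_cases h : 1 ≤ N q
    · simpa only [Ω', if_pos h] using hGne q h
    · simpa only [Ω', if_neg h] using hne q
  · have h0 : Tendsto (fun q => r (N q) q) atTop (𝓝 0) :=
      squeeze_zero (fun q => by positivity) hrN hN1
    have h1 : Tendsto (fun q => 1 - r (N q) q) atTop (𝓝 1) := by simpa using h0.const_sub 1
    refine h1.congr' ?_
    filter_upwards [hpos] with q hq
    rw [hq, hG]
  · rw [Metric.tendsto_nhds]
    intro ε hε
    -- Two thirds of `ε` pay for replacing `f` by `u n` under `ν q` and under `haarX`, the last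
    -- third for the deviation of `u n`, controlled once `N q > n`.
    obtain ⟨n, hn⟩ := hu f (ε / 3) (by positivity)
    filter_upwards [hpos, hN.eventually_gt_atTop n,
      hN1.eventually (gt_mem_nhds (by positivity : (0 : ℝ) < ε / 3))] with q hq hnq hε3
    have hgood : good (N q) (ν q) := (Finset.mem_filter.1 (hq ▸ hν q)).2
    have h1 := abs_integral_sub_le_of_abs_sub_le (μ := (ν q : Measure LatticeSpace.X))
      measure_univ.le (fun x => (hn x).le) (by positivity)
    have h2 := abs_integral_sub_le_of_abs_sub_le (μ := LatticeSpace.haarX)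
      measure_univ.le (fun x => (hn x).le) (by positivity)
    have h3 := (hgood n hnq).trans hε3
    rw [Real.dist_eq]
    rw [abs_lt] at h3 ⊢
    rw [abs_le] at h1 h2
    constructor <;> linarith
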